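/- Let $N\ge 2$ be an integer, let $R,A,B,p,q>0$ with $A\ne B$, and let $g\in C^\infty([0,R])$ be positive; all of these are independent of $\epsilon$. For every $\epsilon>0$ let $U_\epsilon\in C^1([0,R])\cap C^\infty((0,R))$ be a solution of the radial Neumann problem $$\epsilon^2 g(r)\Big[U_\epsilon''(r)+\Big(\tfrac{N-1}{r}+\tfrac{g'(r)}{g(r)}\Big)U_\epsilon'(r)\Big]=\frac{R^N}{N}\left(\frac{Ae^{pU_\epsilon(r)}}{\int_0^R s^{N-1}e^{pU_\epsilon(s)}\,ds}-\frac{Be^{-qU_\epsilon(r)}}{\int_0^R s^{N-1}e^{-qU_\epsilon(s)}\,ds}\right),\quad r\in(0,R),$$ $$\int_0^R s^{N-1}U_\epsilon(s)\,ds=0,\qquad U_\epsilon'(0)=0,\qquad U_\epsilon'(R)=\frac{R(A-B)}{\epsilon^2Ng(R)},$$ and let $$\rho_\epsilon(r)=-\frac{R^N}{N}\left(\frac{Ae^{pU_\epsilon(r)}}{\int_0^R s^{N-1}e^{pU_\epsilon(s)}\,ds}-\frac{Be^{-qU_\epsilon(r)}}{\int_0^R s^{N-1}e^{-qU_\epsilon(s)}\,ds}\right).$$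 Below, $o_\epsilon(1)$ denotes a quantity that tends to $0$ as $\epsilon\downarrow0$. If $A<B$ (resp. $B<A$), then for every $\epsilon>0$ the function $U_\epsilon$ is monotonically decreasing (resp. increasing), in the weak sense, on $[0,R]$. Moreover: (I) For every $\kappa\in(0,1)$ there are constants $C_\kappa,M_\kappa>0$ independent of $\epsilon$ such that, for all sufficiently small $\epsilon>0$, $$\max_{r\in[0,R-\epsilon^\kappa]}|U_\epsilon(r)|\le C_\kappa\,\epsilon^\kappa\log\frac1\epsilon\quad\text{and}\quad\max_{r\in[0,R-\epsilon^\kappa]}r^{N-1}|U_\epsilon'(r)|\le e^{-M_\kappa/\epsilon^{1-\kappa}}.$$ (II) Let $\beta>1$, $\gamma_\beta\in(0,\infty)$, and let $r_\epsilon\in(0,R)$ satisfy $\lim_{\epsilon\downarrow0}\frac{R-r_\epsilon}{\epsilon^\beta}=\gamma_\beta$. Put $\chi_1(\beta)=1$ if $\beta\le2$ and $\chi_1(\beta)=0$ if $\beta>2$; $\chi_2(\beta)=0$ if $\beta<2$ and $\chi_2(\beta)=1$ if $\beta\ge2$. If $A<B$, then $U_\epsilon(r_\epsilon)\to-\infty$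 as $\epsilon\downarrow0$ and $$U_\epsilon(r_\epsilon)=-\frac2q\min\{1,\beta-1\}\log\frac1\epsilon+\frac2q\log\left[\sqrt{\frac{A}{2qg(R)}}\left(\gamma_\beta q\,\chi_1(\beta)+\frac{2Ng(R)}{R(B-A)}\chi_2(\beta)\right)\right]+o_\epsilon(1).$$ Furthermore: (a) if $1<\beta<2$, then $U_\epsilon'(r_\epsilon)=-\frac{2}{\gamma_\beta q}\epsilon^{-\beta}(1+o_\epsilon(1))$ and $\rho_\epsilon(r_\epsilon)=\frac{2g(R)}{\gamma_\beta^2q}\epsilon^{-2(\beta-1)}(1+o_\epsilon(1))$; (b) if $\beta=2$, then $U_\epsilon'(r_\epsilon)=-\frac{2}{\gamma_\beta q+\frac{2Ng(R)}{R(B-A)}}\epsilon^{-2}(1+o_\epsilon(1))$ and $\rho_\epsilon(r_\epsilon)=\frac{2qg(R)}{\left(\gamma_\beta q+\frac{2Ng(R)}{R(B-A)}\right)^2}\epsilon^{-2}(1+o_\epsilon(1))$; (c) if $\beta>2$, then $U_\epsilon'(r_\epsilon)=-\frac{R(B-A)}{Ng(R)}\epsilon^{-2}(1+o_\epsilon(1))$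 and $\rho_\epsilon(r_\epsilon)=\frac{qR^2(B-A)^2}{2N^2g(R)}\epsilon^{-2}(1+o_\epsilon(1))$; in this case $U_\epsilon(R)$ has the same first two terms as $U_\epsilon(r_\epsilon)$, with error $o_\epsilon(1)$, and $U_\epsilon'(R)$ has the same leading term as $U_\epsilon'(r_\epsilon)$. If $B<A$, then $U_\epsilon(r_\epsilon)\to+\infty$ as $\epsilon\downarrow0$ and $$U_\epsilon(r_\epsilon)=\frac2p\min\{1,\beta-1\}\log\frac1\epsilon-\frac2p\log\left[\sqrt{\frac{B}{2pg(R)}}\left(\gamma_\beta p\,\chi_1(\beta)+\frac{2Ng(R)}{R(A-B)}\chi_2(\beta)\right)\right]+o_\epsilon(1),$$ and: (a') if $1<\beta<2$, then $U_\epsilon'(r_\epsilon)=\frac{2}{\gamma_\beta p}\epsilon^{-\beta}(1+o_\epsilon(1))$ and $\rho_\epsilon(r_\epsilon)=-\frac{2g(R)}{\gamma_\beta^2p}\epsilon^{-2(\beta-1)}(1+o_\epsilon(1))$; (b') if $\beta=2$, then $U_\epsilon'(r_\epsilon)=\frac{2}{\gamma_\beta p+\frac{2Ng(R)}{R(A-B)}}\epsilon^{-2}(1+o_\epsilon(1))$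 and $\rho_\epsilon(r_\epsilon)=-\frac{2pg(R)}{\left(\gamma_\beta p+\frac{2Ng(R)}{R(A-B)}\right)^2}\epsilon^{-2}(1+o_\epsilon(1))$; (c') if $\beta>2$, then $U_\epsilon'(r_\epsilon)=\frac{R(A-B)}{Ng(R)}\epsilon^{-2}(1+o_\epsilon(1))$ and $\rho_\epsilon(r_\epsilon)=-\frac{pR^2(A-B)^2}{2N^2g(R)}\epsilon^{-2}(1+o_\epsilon(1))$; in this case $U_\epsilon(R)$ has the same first two terms as $U_\epsilon(r_\epsilon)$, with error $o_\epsilon(1)$, and $U_\epsilon'(R)$ has the same leading term as $U_\epsilon'(r_\epsilon)$. In particular the curvature $1/R$ enters the second-order term of $U_\epsilon(r_\epsilon)$ exactly when $\beta\ge2$. -/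

import Mathlib

open Set Filter Topology Asymptotics
open scoped ContDiff

noncomputable section

namespace RadialPB

/-- Derivative on `[0, R]` (one-sided at the two end points). -/
def D (R : ℝ) (f : ℝ → ℝ) : ℝ → ℝ := derivWithin f (Icc 0 R)

/-- The net charge density `ρ` attached to a radial potential `U`. -/
def chargeDensity (N : ℕ) (R A B p q : ℝ) (U : ℝ → ℝ) (r : ℝ) : ℝ :=
  -(R ^ N / N *
    (A * Real.exp (p * U r) / (∫ s in (0 : ℝ)..R, s ^ (N - 1) * Real.exp (p * U s))
      - B * Real.exp (-q * U r) / (∫ s in (0 : ℝ)..R, s ^ (N - 1) * Real.exp (-q * U s))))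

/-- `U ∈ C¹([0,R]) ∩ C^∞((0,R))` solves the radial Neumann problem (N*) with parameter `ε`. -/
structure IsNeumannSolution (N : ℕ) (R A B p q : ℝ) (g : ℝ → ℝ) (ε : ℝ) (U : ℝ → ℝ) : Prop where
  contDiffOn_Icc : ContDiffOn ℝ 1 U (Icc 0 R)
  contDiffOn_Ioo : ContDiffOn ℝ ∞ U (Ioo 0 R)
  equation : ∀ r ∈ Ioo 0 R,
    ε ^ 2 * g r * (D R (D R U) r + (((N : ℝ) - 1) / r + D R g r / g r) * D R U r)
      = R ^ N / N *
        (A * Real.exp (p * U r) / (∫ s in (0 : ℝ)..R, s ^ (N - 1) * Real.exp (p * U s))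
          - B * Real.exp (-q * U r) / (∫ s in (0 : ℝ)..R, s ^ (N - 1) * Real.exp (-q * U s)))
  mean_zero : ∫ s in (0 : ℝ)..R, s ^ (N - 1) * U s = 0
  deriv_zero : D R U 0 = 0
  deriv_right : D R U R = R * (A - B) / (ε ^ 2 * N * g R)

/-- For `β > 1`: equal to `1` if `β ≤ 2` and to `0` if `β > 2`. -/
def chi1 (β : ℝ) : ℝ := if β ≤ 2 then 1 else 0

/-- For `β > 1`: equal to `0` if `β < 2` and to `1` if `β ≥ 2`. -/
def chi2 (β : ℝ) : ℝ := if 2 ≤ β then 1 else 0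

end RadialPB

end

namespace RadialPB

/-! The reflection `U ↦ -U` exchanges `(A, p)` with `(B, q)`, so only `B < A` has to be analysed. In
divergence form, with flux `w = r^(N-1) g U'` and the increasing nonlinearity `f`, the equation
reads `w' = r^(N-1) f(U) / ε²`; moreover `w(0) = 0`, and `w(R)` is positive of order `ε⁻²`. A
maximum principle gives `w ≥ 0` (`IncSol.flux_nonneg`), hence `U` increases and `f(U) ≥ 0`. With
Jensen's inequality and the zero mean this bounds the nonlocal coefficients above and below, and `U`
below, uniformly in `ε`.

Interior: `y = w + (μ/ε) f(U)` satisfies `y' ≥ (c/ε) y` on `[R/2, R]` (`Params.exists_decay`), so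
flux and charge are exponentially small at distance `ε^κ` from the boundary. There `U` is almost
equal to `U(0)`, and the zero mean forces `U(0)` to be `O(ε^κ log(1/ε))`. Consequently both nonlocal
coefficients tend to `B`.

Boundary layer: with `F' = f`, the energy identity `(ε² w² / 2)' = r^(2(N-1)) g (F(U))'` has an
almost constant weight near `R`. It shows that `ε U' e^(-pU/2) → √(2B/(p g(R)))` at every point
within `o(ε)` of the boundary (`tendsto_D_mul_decayVar`). So `z = e^(-pU/2)` is nearly affine there
with known slope of order `1/ε`, and the Neumann condition fixes `z(R)` at order `ε`. Comparing
`z(R) ~ ε` with the increment `~ ε^(β-1)` gives the threshold `β = 2` (`tendsto_decayVar_div`), and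
`U`, `U'` and the charge density are read off from `z`. -/

theorem le_of_hasDerivAt_nonneg {f f' : ℝ → ℝ} {a b : ℝ} (hab : a ≤ b)
    (hc : ContinuousOn f (Icc a b)) (hd : ∀ x ∈ Ioo a b, HasDerivAt f (f' x) x)
    (h0 : ∀ x ∈ Ioo a b, 0 ≤ f' x) : f a ≤ f b := by
  have hm : MonotoneOn f (Icc a b) := by
    refine monotoneOn_of_deriv_nonneg (convex_Icc a b) hc ?_ ?_
    · rw [interior_Icc]
      exact fun x hx => (hd x hx).differentiableAt.differentiableWithinAt
    · rw [interior_Icc]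
      intro x hx
      rw [(hd x hx).deriv]
      exact h0 x hx
  exact hm (left_mem_Icc.2 hab) (right_mem_Icc.2 hab) hab

theorem lt_of_hasDerivAt_neg {f f' : ℝ → ℝ} {a b : ℝ} (hab : a < b)
    (hc : ContinuousOn f (Icc a b)) (hd : ∀ x ∈ Ioo a b, HasDerivAt f (f' x) x)
    (h0 : ∀ x ∈ Ioo a b, f' x < 0) : f b < f a := by
  have hm : StrictAntiOn f (Icc a b) := by
    refine strictAntiOn_of_deriv_neg (convex_Icc a b) hc ?_
    rw [interior_Icc]
    intro x hx
    rw [(hd x hx).deriv]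
    exact h0 x hx
  exact hm (left_mem_Icc.2 hab.le) (right_mem_Icc.2 hab.le) hab

/-- The data of the problem, in the case `B < A` in which solutions are increasing. -/
structure Params (N : ℕ) (R A B p q : ℝ) (g : ℝ → ℝ) : Prop where
  two_le : 2 ≤ N
  R_pos : 0 < R
  B_pos : 0 < B
  B_lt_A : B < A
  p_pos : 0 < p
  q_pos : 0 < q
  g_smooth : ContDiffOn ℝ ∞ g (Icc 0 R)
  g_pos : ∀ r ∈ Icc 0 R, 0 < g r

/-- A solution of the Neumann problem with `B < A`. -/
structure IncSol (N : ℕ) (R A B p q : ℝ) (g : ℝ → ℝ) (ε : ℝ) (U : ℝ → ℝ) : Prop where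
  par : Params N R A B p q g
  eps_pos : 0 < ε
  sol : IsNeumannSolution N R A B p q g ε U

/-- `R^N/N · A / ∫₀ᴿ s^{N-1} e^{cU}`. -/
noncomputable def coef (N : ℕ) (R A c : ℝ) (U : ℝ → ℝ) : ℝ :=
  R ^ N / N * A / ∫ s in (0 : ℝ)..R, s ^ (N - 1) * Real.exp (c * U s)

/-- The nonlinearity on the right-hand side of the equation. -/
noncomputable def reaction (N : ℕ) (R A B p q : ℝ) (U : ℝ → ℝ) (u : ℝ) : ℝ :=
  coef N R A p U * Real.exp (p * u) - coef N R B (-q) U * Real.exp (-q * u)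

/-- The weighted flux: `r^{N-1} g` times the derivative of `U`. -/
noncomputable def flux (N : ℕ) (R : ℝ) (g U : ℝ → ℝ) (r : ℝ) : ℝ :=
  r ^ (N - 1) * g r * D R U r

theorem chargeDensity_eq_neg_reaction (N : ℕ) (R A B p q : ℝ) (U : ℝ → ℝ) (r : ℝ) :
    chargeDensity N R A B p q U r = -reaction N R A B p q U (U r) := by
  unfold chargeDensity reaction coef
  ring

/-! ### Flux form of the equation, maximum principle and bounds uniform in `ε`. -/

section Fixed

variable {N : ℕ} {R A B p q ε : ℝ} {g U : ℝ → ℝ}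

theorem Params.A_pos (P : Params N R A B p q g) : 0 < A := P.B_pos.trans P.B_lt_A

theorem Params.N_pos (P : Params N R A B p q g) : (0 : ℝ) < N :=
  Nat.cast_pos.2 (by have := P.two_le; omega)

theorem Params.vol_pos (P : Params N R A B p q g) : 0 < R ^ N / N :=
  div_pos (pow_pos P.R_pos N) P.N_pos

theorem IncSol.continuousOn (h : IncSol N R A B p q g ε U) : ContinuousOn U (Icc 0 R) :=
  h.sol.contDiffOn_Icc.continuousOn

theorem IncSol.hasDerivAt (h : IncSol N R A B p q g ε U) {r : ℝ} (hr : r ∈ Ioo 0 R) :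
    HasDerivAt U (D R U r) r :=
  ((h.sol.contDiffOn_Icc.differentiableOn one_ne_zero) r
    (Ioo_subset_Icc_self hr)).hasDerivWithinAt.hasDerivAt (Icc_mem_nhds hr.1 hr.2)

theorem IncSol.continuousOn_D (h : IncSol N R A B p q g ε U) : ContinuousOn (D R U) (Icc 0 R) :=
  h.sol.contDiffOn_Icc.continuousOn_derivWithin (uniqueDiffOn_Icc h.par.R_pos) le_rfl

theorem IncSol.hasDerivAt_D (h : IncSol N R A B p q g ε U) {r : ℝ} (hr : r ∈ Ioo 0 R) :
    HasDerivAt (D R U) (D R (D R U) r) r := by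
  have h1 : ContDiffOn ℝ ∞ (deriv U) (Ioo 0 R) :=
    h.sol.contDiffOn_Ioo.deriv_of_isOpen isOpen_Ioo (by simp)
  have h2 : DifferentiableAt ℝ (deriv U) r :=
    (h1.differentiableOn (by simp)).differentiableAt (isOpen_Ioo.mem_nhds hr)
  have h3 : D R U =ᶠ[𝓝 r] deriv U := by
    filter_upwards [isOpen_Ioo.mem_nhds hr] with x hx
    exact derivWithin_of_mem_nhds (Icc_mem_nhds hx.1 hx.2)
  have h4 : DifferentiableAt ℝ (D R U) r := h2.congr_of_eventuallyEq h3
  have h5 : D R (D R U) r = deriv (D R U) r :=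
    derivWithin_of_mem_nhds (Icc_mem_nhds hr.1 hr.2)
  rw [h5]
  exact h4.hasDerivAt

theorem Params.hasDerivAt_g (P : Params N R A B p q g) {r : ℝ} (hr : r ∈ Ioo 0 R) :
    HasDerivAt g (D R g r) r :=
  ((P.g_smooth.differentiableOn (by simp)) r
    (Ioo_subset_Icc_self hr)).hasDerivWithinAt.hasDerivAt (Icc_mem_nhds hr.1 hr.2)

theorem IncSol.continuousOn_flux (h : IncSol N R A B p q g ε U) :
    ContinuousOn (flux N R g U) (Icc 0 R) :=
  (((continuous_pow _).continuousOn).mul h.par.g_smooth.continuousOn).mul h.continuousOn_D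

theorem continuous_reaction : Continuous (reaction N R A B p q U) := by
  unfold reaction
  fun_prop

theorem IncSol.continuousOn_reaction (h : IncSol N R A B p q g ε U) :
    ContinuousOn (fun r => reaction N R A B p q U (U r)) (Icc 0 R) :=
  continuous_reaction.comp_continuousOn h.continuousOn

theorem hasDerivAt_reaction (u : ℝ) : HasDerivAt (reaction N R A B p q U)
    (p * coef N R A p U * Real.exp (p * u) + q * coef N R B (-q) U * Real.exp (-q * u)) u := by
  have h1 : HasDerivAt (fun u => Real.exp (p * u)) (Real.exp (p * u) * (p * 1)) u :=
    ((hasDerivAt_id u).const_mul p).exp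
  have h2 : HasDerivAt (fun u => Real.exp (-q * u)) (Real.exp (-q * u) * (-q * 1)) u :=
    ((hasDerivAt_id u).const_mul (-q)).exp
  refine ((h1.const_mul (coef N R A p U)).sub (h2.const_mul (coef N R B (-q) U))).congr_deriv ?_
  ring

theorem IncSol.hasDerivAt_flux (h : IncSol N R A B p q g ε U) {r : ℝ} (hr : r ∈ Ioo 0 R) :
    HasDerivAt (flux N R g U) (r ^ (N - 1) * reaction N R A B p q U (U r) / ε ^ 2) r := by
  have hg := (h.par.g_pos r (Ioo_subset_Icc_self hr)).ne'
  have hr0 := hr.1.ne'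
  have hε := h.eps_pos.ne'
  have h1 := ((hasDerivAt_pow (N - 1) r).mul (h.par.hasDerivAt_g hr)).mul (h.hasDerivAt_D hr)
  refine h1.congr_deriv ?_
  have heq := h.sol.equation r hr
  have hre : reaction N R A B p q U (U r) =
      ε ^ 2 * g r * (D R (D R U) r + (((N : ℝ) - 1) / r + D R g r / g r) * D R U r) := by
    rw [heq]; unfold reaction coef; ring
  rw [hre]
  -- Differentiating `r^(N-1)` produces the exponent `N - 1 - 1`; writing `N = n + 2` removes the
  -- truncated subtractions.
  obtain ⟨n, rfl⟩ : ∃ n, N = n + 2 := ⟨N - 2, by have := h.par.two_le; omega⟩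
  simp only [Pi.mul_apply]
  have e1 : n + 2 - 1 = n + 1 := rfl
  have e2 : n + 2 - 1 - 1 = n := rfl
  rw [e2, e1]
  push_cast
  field_simp
  ring

theorem IncSol.flux_zero (h : IncSol N R A B p q g ε U) : flux N R g U 0 = 0 := by
  unfold flux
  rw [h.sol.deriv_zero, mul_zero]

theorem IncSol.flux_right (h : IncSol N R A B p q g ε U) :
    flux N R g U R = R ^ N / N * (A - B) / ε ^ 2 := by
  unfold flux
  rw [h.sol.deriv_right]
  have hg := (h.par.g_pos R (right_mem_Icc.2 h.par.R_pos.le)).ne'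
  have hε := h.eps_pos.ne'
  have hN := h.par.N_pos.ne'
  have e : R ^ N = R ^ (N - 1) * R := by
    rw [← pow_succ]; congr 1; have := h.par.two_le; omega
  rw [e]
  field_simp

theorem IncSol.integrable_exp (h : IncSol N R A B p q g ε U) (c : ℝ) :
    IntervalIntegrable (fun s => s ^ (N - 1) * Real.exp (c * U s)) MeasureTheory.volume 0 R := by
  apply ContinuousOn.intervalIntegrable
  rw [uIcc_of_le h.par.R_pos.le]
  exact (continuous_pow _).continuousOn.mul
    (Real.continuous_exp.comp_continuousOn (continuousOn_const.mul h.continuousOn))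

theorem IncSol.integrable_pow_mul (h : IncSol N R A B p q g ε U) :
    IntervalIntegrable (fun s => s ^ (N - 1) * U s) MeasureTheory.volume 0 R := by
  apply ContinuousOn.intervalIntegrable
  rw [uIcc_of_le h.par.R_pos.le]
  exact (continuous_pow _).continuousOn.mul h.continuousOn

theorem Params.integral_pow (P : Params N R A B p q g) :
    ∫ s in (0 : ℝ)..R, s ^ (N - 1) = R ^ N / N := by
  rw [_root_.integral_pow]
  have e : N - 1 + 1 = N := by have := P.two_le; omega
  have e' : ((N - 1 : ℕ) : ℝ) + 1 = N := by exact_mod_cast e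
  rw [e, e', zero_pow (by have := P.two_le; omega)]
  ring

/-- Jensen's inequality for the zero-mean function `U`. -/
theorem IncSol.vol_le_integral_exp (h : IncSol N R A B p q g ε U) (c : ℝ) :
    R ^ N / N ≤ ∫ s in (0 : ℝ)..R, s ^ (N - 1) * Real.exp (c * U s) := by
  have hi : IntervalIntegrable (fun s : ℝ => s ^ (N - 1)) MeasureTheory.volume 0 R :=
    (continuous_pow _).intervalIntegrable _ _
  -- The tangent-line bound `1 + x ≤ e^x` suffices, because its linear term integrates to zero.
  have h1 : ∫ s in (0 : ℝ)..R, (s ^ (N - 1) + c * (s ^ (N - 1) * U s)) = R ^ N / N := by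
    rw [intervalIntegral.integral_add hi (h.integrable_pow_mul.const_mul c),
      intervalIntegral.integral_const_mul, h.sol.mean_zero, h.par.integral_pow]
    ring
  rw [← h1]
  refine intervalIntegral.integral_mono_on h.par.R_pos.le
    (hi.add (h.integrable_pow_mul.const_mul c)) (h.integrable_exp c) ?_
  intro s hs
  have h2 := Real.add_one_le_exp (c * U s)
  have h3 : 0 ≤ s ^ (N - 1) := pow_nonneg hs.1 _
  nlinarith

theorem IncSol.integral_exp_pos (h : IncSol N R A B p q g ε U) (c : ℝ) :
    0 < ∫ s in (0 : ℝ)..R, s ^ (N - 1) * Real.exp (c * U s) :=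
  h.par.vol_pos.trans_le (h.vol_le_integral_exp c)

theorem IncSol.coef_pos (h : IncSol N R A B p q g ε U) {K : ℝ} (hK : 0 < K) (c : ℝ) :
    0 < coef N R K c U :=
  div_pos (mul_pos h.par.vol_pos hK) (h.integral_exp_pos c)

theorem IncSol.coef_le (h : IncSol N R A B p q g ε U) {K : ℝ} (hK : 0 < K) (c : ℝ) :
    coef N R K c U ≤ K := by
  unfold coef
  rw [div_le_iff₀ (h.integral_exp_pos c)]
  nlinarith [h.vol_le_integral_exp c]

theorem IncSol.reaction_strictMono (h : IncSol N R A B p q g ε U) :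
    StrictMono (reaction N R A B p q U) := by
  refine strictMono_of_deriv_pos fun u => ?_
  rw [(hasDerivAt_reaction u).deriv]
  have := h.coef_pos h.par.A_pos p
  have := h.coef_pos h.par.B_pos (-q)
  have := h.par.p_pos
  have := h.par.q_pos
  positivity

/-- Maximum principle. A negative minimum of the flux is interior, since the boundary values are
nonnegative, so the reaction vanishes there. But `U' < 0` at that point, so just to its right `U` is
smaller, the strictly increasing reaction is negative, and the flux drops below its minimum. -/
theorem IncSol.flux_nonneg (h : IncSol N R A B p q g ε U) {r : ℝ} (hr : r ∈ Icc 0 R) :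
    0 ≤ flux N R g U r := by
  have hR := h.par.R_pos
  obtain ⟨m, hm, hmin⟩ := isCompact_Icc.exists_isMinOn (nonempty_Icc.2 hR.le) h.continuousOn_flux
  by_contra! hneg
  have hwm : flux N R g U m < 0 := (hmin hr).trans_lt hneg
  have hm0 : m ≠ 0 := by
    rintro rfl; rw [h.flux_zero] at hwm; exact lt_irrefl _ hwm
  have hmR : m ≠ R := by
    rintro rfl
    rw [h.flux_right] at hwm
    have h1 := h.par.vol_pos
    have h2 := h.eps_pos
    have h3 := sub_pos.2 h.par.B_lt_A
    have : 0 < m ^ N / N * (A - B) / ε ^ 2 := by positivity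
    linarith
  have hmI : m ∈ Ioo 0 R := ⟨lt_of_le_of_ne hm.1 hm0.symm, lt_of_le_of_ne hm.2 hmR⟩
  have hloc : IsLocalMin (flux N R g U) m := by
    filter_upwards [Icc_mem_nhds hmI.1 hmI.2] with x hx using hmin hx
  have hd0 := hloc.hasDerivAt_eq_zero (h.hasDerivAt_flux hmI)
  have hre : reaction N R A B p q U (U m) = 0 := by
    simpa [hm0, h.eps_pos.ne'] using hd0
  have hV : D R U m < 0 := by
    by_contra! hV
    have := h.par.g_pos m hm
    have : 0 ≤ flux N R g U m := mul_nonneg (mul_nonneg (pow_nonneg hm.1 _) this.le) hV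
    linarith
  have hev : ∀ᶠ x in 𝓝 m, D R U x < 0 ∧ x ∈ Ioo 0 R :=
    ((h.hasDerivAt_D hmI).continuousAt.eventually_lt continuousAt_const hV).and
      (isOpen_Ioo.mem_nhds hmI)
  obtain ⟨η, hη, hball⟩ := Metric.eventually_nhds_iff.1 hev
  have hin : ∀ x ∈ Icc m (m + η / 2), D R U x < 0 ∧ x ∈ Ioo 0 R := fun x hx => hball (by
    rw [Real.dist_eq, abs_of_nonneg (by linarith [hx.1])]; linarith [hx.2])
  have hUlt : ∀ x ∈ Ioo m (m + η / 2), U x < U m := fun x hx =>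
    lt_of_hasDerivAt_neg hx.1
      (h.continuousOn.mono fun y hy =>
        Ioo_subset_Icc_self (hin y ⟨hy.1, hy.2.trans hx.2.le⟩).2)
      (fun y hy => h.hasDerivAt (hin y ⟨hy.1.le, (hy.2.trans hx.2).le⟩).2)
      (fun y hy => (hin y ⟨hy.1.le, (hy.2.trans hx.2).le⟩).1)
  have hlt : flux N R g U (m + η / 2) < flux N R g U m := by
    refine lt_of_hasDerivAt_neg (by linarith)
      (h.continuousOn_flux.mono fun y hy => Ioo_subset_Icc_self (hin y hy).2)
      (fun y hy => h.hasDerivAt_flux (hin y (Ioo_subset_Icc_self hy)).2) fun y hy => ?_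
    have h1 := h.reaction_strictMono (hUlt y hy)
    rw [hre] at h1
    have h2 : 0 < y ^ (N - 1) := pow_pos (hmI.1.trans hy.1) _
    exact div_neg_of_neg_of_pos (mul_neg_of_pos_of_neg h2 h1) (pow_pos h.eps_pos 2)
  exact absurd (hmin (Ioo_subset_Icc_self (hin _ ⟨by linarith, le_rfl⟩).2)) (not_le.2 hlt)

theorem IncSol.D_nonneg (h : IncSol N R A B p q g ε U) {r : ℝ} (hr : r ∈ Icc 0 R) :
    0 ≤ D R U r := by
  rcases hr.1.eq_or_lt with rfl | h0
  · rw [h.sol.deriv_zero]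
  · have h1 : 0 < r ^ (N - 1) * g r := mul_pos (pow_pos h0 _) (h.par.g_pos r hr)
    exact nonneg_of_mul_nonneg_right (h.flux_nonneg hr) h1

theorem IncSol.monotoneOn (h : IncSol N R A B p q g ε U) : MonotoneOn U (Icc 0 R) := by
  intro x hx y hy hxy
  exact le_of_hasDerivAt_nonneg hxy (h.continuousOn.mono (Icc_subset_Icc hx.1 hy.2))
    (fun z hz => h.hasDerivAt ⟨hx.1.trans_lt hz.1, hz.2.trans_le hy.2⟩)
    (fun z hz => h.D_nonneg ⟨hx.1.trans hz.1.le, hz.2.le.trans hy.2⟩)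

/-- Monotonicity reduces the claim to `r = 0`. A negative reaction at the origin would push the flux
below its initial value `0`. -/
theorem IncSol.reaction_nonneg (h : IncSol N R A B p q g ε U) {r : ℝ} (hr : r ∈ Icc 0 R) :
    0 ≤ reaction N R A B p q U (U r) := by
  have hR := h.par.R_pos
  have h0 : (0 : ℝ) ∈ Icc 0 R := left_mem_Icc.2 hR.le
  refine le_trans ?_ (h.reaction_strictMono.monotone (h.monotoneOn h0 hr hr.1))
  by_contra! hneg
  have hev : ∀ᶠ x in 𝓝[Icc 0 R] 0, reaction N R A B p q U (U x) < 0 :=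
    (h.continuousOn_reaction 0 h0).eventually_lt continuousWithinAt_const hneg
  obtain ⟨η, hη, hball⟩ := Metric.mem_nhdsWithin_iff.1 hev
  set y := min (η / 2) (R / 2) with hy
  have hy0 : 0 < y := lt_min (by linarith) (by linarith)
  have hyR : y < R := (min_le_right _ _).trans_lt (by linarith)
  have hlt : flux N R g U y < flux N R g U 0 := by
    refine lt_of_hasDerivAt_neg hy0
      (h.continuousOn_flux.mono (Icc_subset_Icc le_rfl hyR.le))
      (fun x hx => h.hasDerivAt_flux ⟨hx.1, hx.2.trans hyR⟩) fun x hx => ?_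
    have h1 : reaction N R A B p q U (U x) < 0 := by
      refine hball ⟨?_, hx.1.le, (hx.2.trans hyR).le⟩
      rw [Metric.mem_ball, Real.dist_eq, sub_zero, abs_of_pos hx.1]
      linarith [hx.2, min_le_left (η / 2) (R / 2)]
    exact div_neg_of_neg_of_pos (mul_neg_of_pos_of_neg (pow_pos hx.1 _) h1)
      (pow_pos h.eps_pos 2)
  rw [h.flux_zero] at hlt
  exact absurd (h.flux_nonneg ⟨hy0.le, hyR.le⟩) (not_le.2 hlt)

theorem IncSol.flux_monotoneOn (h : IncSol N R A B p q g ε U) :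
    MonotoneOn (flux N R g U) (Icc 0 R) := by
  intro x hx y hy hxy
  refine le_of_hasDerivAt_nonneg hxy (h.continuousOn_flux.mono (Icc_subset_Icc hx.1 hy.2))
    (fun z hz => h.hasDerivAt_flux ⟨hx.1.trans_lt hz.1, hz.2.trans_le hy.2⟩) fun z hz => ?_
  have h1 := h.reaction_nonneg ⟨hx.1.trans hz.1.le, hz.2.le.trans hy.2⟩
  have h2 : 0 ≤ z ^ (N - 1) := pow_nonneg (hx.1.trans hz.1.le) _
  have := h.eps_pos
  positivity

theorem IncSol.U_zero_nonpos (h : IncSol N R A B p q g ε U) : U 0 ≤ 0 := by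
  have hR := h.par.R_pos
  have h1 : ∫ s in (0 : ℝ)..R, s ^ (N - 1) * U 0 ≤ ∫ s in (0 : ℝ)..R, s ^ (N - 1) * U s := by
    refine intervalIntegral.integral_mono_on hR.le
      ((by fun_prop : Continuous fun s : ℝ => s ^ (N - 1) * U 0).intervalIntegrable _ _)
      h.integrable_pow_mul fun s hs => ?_
    exact mul_le_mul_of_nonneg_left (h.monotoneOn (left_mem_Icc.2 hR.le) hs hs.1)
      (pow_nonneg hs.1 _)
  rw [h.sol.mean_zero, intervalIntegral.integral_mul_const, h.par.integral_pow] at h1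
  exact nonpos_of_mul_nonpos_right h1 h.par.vol_pos

theorem IncSol.integral_exp_neg_le (h : IncSol N R A B p q g ε U) :
    ∫ s in (0 : ℝ)..R, s ^ (N - 1) * Real.exp (-q * U s) ≤ R ^ N / N * Real.exp (-q * U 0) := by
  have hR := h.par.R_pos
  rw [← h.par.integral_pow, ← intervalIntegral.integral_mul_const]
  refine intervalIntegral.integral_mono_on hR.le (h.integrable_exp _)
    ((by fun_prop : Continuous fun s : ℝ => s ^ (N - 1) * Real.exp (-q * U 0)).intervalIntegrable
      _ _) fun s hs => ?_
  refine mul_le_mul_of_nonneg_left (Real.exp_le_exp.2 ?_) (pow_nonneg hs.1 _)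
  have := h.monotoneOn (left_mem_Icc.2 hR.le) hs hs.1
  nlinarith [h.par.q_pos]

theorem IncSol.le_coef_neg (h : IncSol N R A B p q g ε U) :
    B * Real.exp (q * U 0) ≤ coef N R B (-q) U := by
  unfold coef
  rw [le_div_iff₀ (h.integral_exp_pos _)]
  have h1 := h.integral_exp_neg_le
  have h2 : Real.exp (q * U 0) * Real.exp (-q * U 0) = 1 := by
    rw [← Real.exp_add]; simp
  have h3 : 0 < B * Real.exp (q * U 0) := mul_pos h.par.B_pos (Real.exp_pos _)
  calc _ ≤ B * Real.exp (q * U 0) * (R ^ N / N * Real.exp (-q * U 0)) :=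
        mul_le_mul_of_nonneg_left h1 h3.le
    _ = R ^ N / N * B * (Real.exp (q * U 0) * Real.exp (-q * U 0)) := by ring
    _ = _ := by rw [h2, mul_one]

theorem IncSol.coef_neg_mul_exp_le (h : IncSol N R A B p q g ε U) :
    coef N R B (-q) U * Real.exp (-q * U 0) ≤ coef N R A p U * Real.exp (p * U 0) :=
  sub_nonneg.1 (h.reaction_nonneg (left_mem_Icc.2 h.par.R_pos.le))

/-- A lower bound for all solutions, uniform in `ε`. -/
noncomputable def lowerBound (A B p : ℝ) : ℝ := Real.log (B / A) / p

/-- With `α`, `δ` the coefficients of the two exponentials, this is the chain `B ≤ δ e^(-q U(0)) ≤ α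
e^(p U(0)) ≤ A e^(p U(0))`: the first from `U ≥ U(0)`, the second from the sign of the reaction at
`0`, the third from Jensen. -/
theorem IncSol.lowerBound_le_zero (h : IncSol N R A B p q g ε U) : lowerBound A B p ≤ U 0 := by
  have hA := h.par.A_pos
  have hB := h.par.B_pos
  have h1 : B ≤ A * Real.exp (p * U 0) := by
    have h2 := mul_le_mul_of_nonneg_right h.le_coef_neg (Real.exp_pos (-q * U 0)).le
    have h3 : Real.exp (q * U 0) * Real.exp (-q * U 0) = 1 := by
      rw [← Real.exp_add]; simp
    rw [mul_assoc, h3, mul_one] at h2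
    exact (h2.trans h.coef_neg_mul_exp_le).trans
      (mul_le_mul_of_nonneg_right (h.coef_le hA p) (Real.exp_pos _).le)
  unfold lowerBound
  rw [div_le_iff₀ h.par.p_pos, Real.log_le_iff_le_exp (div_pos hB hA), div_le_iff₀ hA, mul_comm _ p]
  linarith

theorem IncSol.lowerBound_le (h : IncSol N R A B p q g ε U) {r : ℝ} (hr : r ∈ Icc 0 R) :
    lowerBound A B p ≤ U r :=
  h.lowerBound_le_zero.trans (h.monotoneOn (left_mem_Icc.2 h.par.R_pos.le) hr hr.1)

theorem IncSol.coef_neg_lower (h : IncSol N R A B p q g ε U) :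
    B * Real.exp (q * lowerBound A B p) ≤ coef N R B (-q) U := by
  refine le_trans (mul_le_mul_of_nonneg_left (Real.exp_le_exp.2 ?_) h.par.B_pos.le) h.le_coef_neg
  exact mul_le_mul_of_nonneg_left h.lowerBound_le_zero h.par.q_pos.le

theorem IncSol.coef_neg_le_coef (h : IncSol N R A B p q g ε U) :
    coef N R B (-q) U ≤ coef N R A p U := by
  have h0 := h.U_zero_nonpos
  have h1 : 1 ≤ Real.exp (-q * U 0) := Real.one_le_exp (by nlinarith [h.par.q_pos])
  have h2 : Real.exp (p * U 0) ≤ 1 := Real.exp_le_one_iff.2 (by nlinarith [h.par.p_pos])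
  nlinarith [h.coef_neg_mul_exp_le, h.coef_pos h.par.A_pos p, h.coef_pos h.par.B_pos (-q)]

theorem IncSol.coef_lower (h : IncSol N R A B p q g ε U) :
    B * Real.exp (q * lowerBound A B p) ≤ coef N R A p U :=
  h.coef_neg_lower.trans h.coef_neg_le_coef

theorem IncSol.integral_exp_le (h : IncSol N R A B p q g ε U) :
    ∫ s in (0 : ℝ)..R, s ^ (N - 1) * Real.exp (p * U s) ≤
      R ^ N / N * A / (B * Real.exp (q * lowerBound A B p)) := by
  have h1 := h.coef_lower
  unfold coef at h1
  rw [le_div_iff₀ (h.integral_exp_pos _)] at h1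
  rw [le_div_iff₀ (mul_pos h.par.B_pos (Real.exp_pos _))]
  linarith

end Fixed

/-! ### Quantitative estimates for a single solution. -/

section Estimates

variable {N : ℕ} {R A B p q ε : ℝ} {g U : ℝ → ℝ}

theorem Params.exists_g_bounds (P : Params N R A B p q g) :
    ∃ m > 0, ∃ K > 0, ∀ r ∈ Icc 0 R, m ≤ g r ∧ g r ≤ K := by
  have hne : (Icc 0 R).Nonempty := nonempty_Icc.2 P.R_pos.le
  obtain ⟨x, hx, hmin⟩ := isCompact_Icc.exists_isMinOn hne P.g_smooth.continuousOn
  obtain ⟨y, hy, hmax⟩ := isCompact_Icc.exists_isMaxOn hne P.g_smooth.continuousOn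
  exact ⟨g x, P.g_pos x hx, g y, P.g_pos y hy, fun r hr => ⟨hmin hr, hmax hr⟩⟩

theorem IncSol.reaction_mono (h : IncSol N R A B p q g ε U) {x y : ℝ} (hx : 0 ≤ x) (hxy : x ≤ y)
    (hy : y ≤ R) : reaction N R A B p q U (U x) ≤ reaction N R A B p q U (U y) :=
  h.reaction_strictMono.monotone (h.monotoneOn ⟨hx, hxy.trans hy⟩ ⟨hx.trans hxy, hy⟩ hxy)

/-- Since the total charge is bounded, the charge density at distance `t` from the boundary
is `O(1/t)`. -/
theorem IncSol.reaction_mul_le (h : IncSol N R A B p q g ε U) {r : ℝ} (hr : R / 2 ≤ r)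
    (hrR : r ≤ R) :
    reaction N R A B p q U (U r) * ((R / 2) ^ (N - 1) * (R - r)) ≤ R ^ N / N * (A - B) := by
  have hR := h.par.R_pos
  have hε := pow_pos h.eps_pos 2
  have hr0 : 0 ≤ r := by linarith
  set k := reaction N R A B p q U (U r) with hk
  have hk0 : 0 ≤ k := h.reaction_nonneg ⟨hr0, hrR⟩
  -- On `[r, R]` the flux grows at least at the rate `k (R/2)^(N-1) / ε²`, since the reaction is
  -- nondecreasing in the radius.
  have h1 : flux N R g U r - k * (R / 2) ^ (N - 1) / ε ^ 2 * r ≤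
      flux N R g U R - k * (R / 2) ^ (N - 1) / ε ^ 2 * R := by
    refine le_of_hasDerivAt_nonneg
      (f := fun x => flux N R g U x - k * (R / 2) ^ (N - 1) / ε ^ 2 * x) hrR
      ((h.continuousOn_flux.mono (Icc_subset_Icc hr0 le_rfl)).sub (by fun_prop))
      (fun x hx => (h.hasDerivAt_flux ⟨hr0.trans_lt hx.1, hx.2⟩).sub
        ((hasDerivAt_id x).const_mul _)) fun x hx => ?_
    have h2 : k ≤ reaction N R A B p q U (U x) := h.reaction_mono hr0 hx.1.le hx.2.le
    have h3 : (R / 2) ^ (N - 1) ≤ x ^ (N - 1) :=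
      pow_le_pow_left₀ (by linarith) (hr.trans hx.1.le) _
    rw [mul_one, ← sub_div]
    refine div_nonneg (sub_nonneg.2 ?_) hε.le
    rw [mul_comm]
    exact mul_le_mul h3 h2 hk0 (pow_nonneg (hr0.trans hx.1.le) _)
  have h2 := h.flux_nonneg ⟨hr0, hrR⟩
  rw [h.flux_right] at h1
  have h3 : k * (R / 2) ^ (N - 1) / ε ^ 2 * (R - r) ≤ R ^ N / N * (A - B) / ε ^ 2 := by
    nlinarith
  rw [div_mul_eq_mul_div, div_le_div_iff_of_pos_right hε] at h3
  linarith

/-- Exponential decay away from the boundary. -/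
theorem Params.exists_decay (P : Params N R A B p q g) : ∃ c > 0, ∃ μ > 0, ∀ (ε : ℝ) (U : ℝ → ℝ),
    IncSol N R A B p q g ε U → ∀ r s, R / 2 ≤ r → r ≤ s → s ≤ R →
      flux N R g U r + μ / ε * reaction N R A B p q U (U r) ≤
        Real.exp (-(c / ε) * (s - r)) *
          (flux N R g U s + μ / ε * reaction N R A B p q U (U s)) := by
  obtain ⟨m, hm, K, hK, hgK⟩ := P.exists_g_bounds
  have hR := P.R_pos
  have hB := P.B_pos
  have hp := P.p_pos
  have hq := P.q_pos
  set l := lowerBound A B p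
  -- Here `c0` bounds `f'(U)` from below, `c1` is such that `f'(U) U' ≥ c1 w`, and `c2` bounds
  -- `x^(N-1)` from below on `[R/2, R]`.
  set c0 := p * (B * Real.exp (q * l)) * Real.exp (p * l) with hc0
  have hc0' : 0 < c0 := by positivity
  set c1 := c0 / (R ^ (N - 1) * K) with hc1
  have hc1' : 0 < c1 := by positivity
  set c2 := (R / 2) ^ (N - 1) with hc2
  have hc2' : 0 < c2 := by positivity
  -- The relation `μ² c1 = c2` turns the lower bound `c2 f/ε² + (μ/ε) c1 w` for `y'` into exactly
  -- `(μ c1/ε) y`, where `y = w + (μ/ε) f`.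
  set μ := √(c2 / c1) with hμ
  have hμ' : 0 < μ := Real.sqrt_pos.2 (by positivity)
  have hμ2 : μ ^ 2 * c1 = c2 := by
    rw [hμ, Real.sq_sqrt (by positivity)]; field_simp
  refine ⟨μ * c1, by positivity, μ, hμ', fun ε U h r s hr hrs hs => ?_⟩
  have hε := h.eps_pos
  have hr0 : 0 < r := by linarith
  set L := μ * c1 / ε with hL
  have key : Real.exp (-L * r) *
        (flux N R g U r + μ / ε * reaction N R A B p q U (U r)) ≤
      Real.exp (-L * s) * (flux N R g U s + μ / ε * reaction N R A B p q U (U s)) := by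
    refine le_of_hasDerivAt_nonneg
      (f := fun x => Real.exp (-L * x) *
        (flux N R g U x + μ / ε * reaction N R A B p q U (U x)))
      (f' := fun x => Real.exp (-L * x) * (-L * 1) *
        (flux N R g U x + μ / ε * reaction N R A B p q U (U x)) + Real.exp (-L * x) *
        (x ^ (N - 1) * reaction N R A B p q U (U x) / ε ^ 2 + μ / ε *
          ((p * coef N R A p U * Real.exp (p * U x) +
            q * coef N R B (-q) U * Real.exp (-q * U x)) * D R U x))) hrs ?_ ?_ ?_
    · refine ContinuousOn.mul (by fun_prop) (ContinuousOn.add ?_ (continuousOn_const.mul ?_))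
      · exact h.continuousOn_flux.mono (Icc_subset_Icc hr0.le hs)
      · exact h.continuousOn_reaction.mono (Icc_subset_Icc hr0.le hs)
    · intro x hx
      have hx' : x ∈ Ioo 0 R := ⟨hr0.trans hx.1, hx.2.trans_le hs⟩
      exact (((hasDerivAt_id x).const_mul (-L)).exp).mul ((h.hasDerivAt_flux hx').add
        (((hasDerivAt_reaction (U x)).comp x (h.hasDerivAt hx')).const_mul (μ / ε)))
    · intro x hx
      have hx' : x ∈ Icc 0 R := ⟨(hr0.trans hx.1).le, (hx.2.trans_le hs).le⟩
      have hx0 : 0 < x := hr0.trans hx.1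
      have hV := h.D_nonneg hx'
      have hre := h.reaction_nonneg hx'
      have a1 : c2 ≤ x ^ (N - 1) := pow_le_pow_left₀ (by linarith) (hr.trans hx.1.le) _
      have a2 : c0 ≤ p * coef N R A p U * Real.exp (p * U x) +
            q * coef N R B (-q) U * Real.exp (-q * U x) := by
        have b1 : c0 ≤ p * coef N R A p U * Real.exp (p * U x) := by
          rw [hc0]
          have := h.lowerBound_le hx'
          have := h.coef_lower
          have := h.coef_pos P.A_pos p
          gcongr
        have b2 : 0 ≤ q * coef N R B (-q) U * Real.exp (-q * U x) := by
          have := h.coef_pos hB (-q)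
          positivity
        linarith
      have a3 : c1 * flux N R g U x ≤ c0 * D R U x := by
        have b1 : x ^ (N - 1) * g x ≤ R ^ (N - 1) * K :=
          mul_le_mul (pow_le_pow_left₀ hx0.le hx'.2 _) (hgK x hx').2 (P.g_pos x hx').le
            (by positivity)
        rw [hc1, div_mul_eq_mul_div, div_le_iff₀ (by positivity)]
        unfold flux
        nlinarith [mul_le_mul_of_nonneg_right b1 (mul_nonneg hc0'.le hV)]
      have a4 : c2 * reaction N R A B p q U (U x) / ε ^ 2 ≤
          x ^ (N - 1) * reaction N R A B p q U (U x) / ε ^ 2 := by gcongr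
      have a5 : μ / ε * (c1 * flux N R g U x) ≤ μ / ε *
          ((p * coef N R A p U * Real.exp (p * U x) +
            q * coef N R B (-q) U * Real.exp (-q * U x)) * D R U x) := by
        refine mul_le_mul_of_nonneg_left (a3.trans ?_) (by positivity)
        exact mul_le_mul_of_nonneg_right a2 hV
      have a6 : L * (flux N R g U x + μ / ε * reaction N R A B p q U (U x)) =
          μ / ε * (c1 * flux N R g U x) + c2 * reaction N R A B p q U (U x) / ε ^ 2 := by
        rw [hL, ← hμ2]; field_simp
      have a7 := Real.exp_pos (-L * x)
      have : Real.exp (-L * x) * (-L * 1) *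
        (flux N R g U x + μ / ε * reaction N R A B p q U (U x)) + Real.exp (-L * x) *
        (x ^ (N - 1) * reaction N R A B p q U (U x) / ε ^ 2 + μ / ε *
          ((p * coef N R A p U * Real.exp (p * U x) +
            q * coef N R B (-q) U * Real.exp (-q * U x)) * D R U x)) =
        Real.exp (-L * x) * ((x ^ (N - 1) * reaction N R A B p q U (U x) / ε ^ 2 + μ / ε *
          ((p * coef N R A p U * Real.exp (p * U x) +
            q * coef N R B (-q) U * Real.exp (-q * U x)) * D R U x)) -
          L * (flux N R g U x + μ / ε * reaction N R A B p q U (U x))) := by ring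
      rw [this, a6]
      exact mul_nonneg a7.le (by linarith)
  have e1 : Real.exp (-(μ * c1 / ε) * (s - r)) = Real.exp (L * r) * Real.exp (-L * s) := by
    rw [← Real.exp_add]; congr 1; rw [hL]; ring
  have e2 : Real.exp (L * r) * Real.exp (-L * r) = 1 := by
    rw [← Real.exp_add]; simp
  calc _ = Real.exp (L * r) * Real.exp (-L * r) *
        (flux N R g U r + μ / ε * reaction N R A B p q U (U r)) := by rw [e2, one_mul]
    _ = Real.exp (L * r) * (Real.exp (-L * r) *
        (flux N R g U r + μ / ε * reaction N R A B p q U (U r))) := by ring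
    _ ≤ Real.exp (L * r) * (Real.exp (-L * s) *
        (flux N R g U s + μ / ε * reaction N R A B p q U (U s))) :=
        mul_le_mul_of_nonneg_left key (Real.exp_pos _).le
    _ = _ := by rw [e1]; ring

/-- The factor `r^N` lets the bound survive division by the degenerate weight `r^(N-1)`, so `U'` is
controlled up to the origin. -/
theorem IncSol.flux_le (h : IncSol N R A B p q g ε U) {r : ℝ} (hr : r ∈ Icc 0 R) :
    flux N R g U r ≤ reaction N R A B p q U (U r) / (N * ε ^ 2) * r ^ N := by
  have hN := h.par.N_pos
  have hε := h.eps_pos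
  have hN0 : N ≠ 0 := by have := h.par.two_le; omega
  set k := reaction N R A B p q U (U r) with hk
  have h1 : k / (N * ε ^ 2) * 0 ^ N - flux N R g U 0 ≤
      k / (N * ε ^ 2) * r ^ N - flux N R g U r := by
    refine le_of_hasDerivAt_nonneg (f := fun x => k / (N * ε ^ 2) * x ^ N - flux N R g U x) hr.1
      (ContinuousOn.sub (by fun_prop) (h.continuousOn_flux.mono (Icc_subset_Icc le_rfl hr.2)))
      (fun x hx => ((hasDerivAt_pow N x).const_mul _).sub
        (h.hasDerivAt_flux ⟨hx.1, hx.2.trans_le hr.2⟩)) fun x hx => ?_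
    have h2 := h.reaction_mono hx.1.le hx.2.le hr.2
    have h3 : 0 < x ^ (N - 1) := pow_pos hx.1 _
    have h4 : k / (N * ε ^ 2) * (N * x ^ (N - 1)) = x ^ (N - 1) * k / ε ^ 2 := by field_simp
    rw [h4, ← sub_div]
    refine div_nonneg (sub_nonneg.2 ?_) (by positivity)
    exact mul_le_mul_of_nonneg_left h2 h3.le
  rw [h.flux_zero, zero_pow hN0] at h1
  linarith

theorem IncSol.U_sub_U_zero_le (h : IncSol N R A B p q g ε U) {m : ℝ} (hm : 0 < m)
    (hgm : ∀ r ∈ Icc 0 R, m ≤ g r) {r : ℝ} (hr : r ∈ Icc 0 R) :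
    U r - U 0 ≤ R ^ 2 / (N * m) * (reaction N R A B p q U (U r) / ε ^ 2) := by
  have hN := h.par.N_pos
  have hε := h.eps_pos
  have hR := h.par.R_pos
  set k := reaction N R A B p q U (U r) with hk
  have hk0 : 0 ≤ k := h.reaction_nonneg hr
  have h1 : k * R / (N * ε ^ 2 * m) * 0 - U 0 ≤ k * R / (N * ε ^ 2 * m) * r - U r := by
    refine le_of_hasDerivAt_nonneg (f := fun x => k * R / (N * ε ^ 2 * m) * x - U x) hr.1
      (ContinuousOn.sub (by fun_prop) (h.continuousOn.mono (Icc_subset_Icc le_rfl hr.2)))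
      (fun x hx => ((hasDerivAt_id x).const_mul _).sub
        (h.hasDerivAt ⟨hx.1, hx.2.trans_le hr.2⟩)) fun x hx => ?_
    have hx' : x ∈ Icc 0 R := ⟨hx.1.le, hx.2.le.trans hr.2⟩
    have hre := h.reaction_mono hx.1.le hx.2.le hr.2
    have h2 := h.flux_le hx'
    have h3 : 0 < x ^ (N - 1) := pow_pos hx.1 _
    have e : x ^ N = x ^ (N - 1) * x := by
      rw [← pow_succ]; congr 1; have := h.par.two_le; omega
    have hV := h.D_nonneg hx'
    have h4 : g x * D R U x ≤ k / (N * ε ^ 2) * x := by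
      have h5 : x ^ (N - 1) * (g x * D R U x) ≤ x ^ (N - 1) * (k / (N * ε ^ 2) * x) := by
        calc x ^ (N - 1) * (g x * D R U x) = flux N R g U x := by unfold flux; ring
          _ ≤ _ := h2
          _ ≤ k / (N * ε ^ 2) * x ^ N := by
            have := hx.1
            gcongr
          _ = _ := by rw [e]; ring
      exact le_of_mul_le_mul_left h5 h3
    have h6 : m * D R U x ≤ k / (N * ε ^ 2) * R := by
      calc m * D R U x ≤ g x * D R U x := mul_le_mul_of_nonneg_right (hgm x hx') hV
        _ ≤ _ := h4
        _ ≤ _ := mul_le_mul_of_nonneg_left hx'.2 (by positivity)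
    have h7 : D R U x ≤ k / (N * ε ^ 2) * R / m := by
      rw [le_div_iff₀ hm]; linarith
    have e2 : k * R / (N * ε ^ 2 * m) * 1 = k / (N * ε ^ 2) * R / m := by field_simp
    rw [e2]; linarith
  have h2 : k * R / (N * ε ^ 2 * m) * r ≤ k * R / (N * ε ^ 2 * m) * R :=
    mul_le_mul_of_nonneg_left hr.2 (by positivity)
  have e : R ^ 2 / (N * m) * (k / ε ^ 2) = k * R / (N * ε ^ 2 * m) * R := by field_simp
  rw [e]; linarith

/-- The zero-mean condition controls `U(0)` through the size of `U` in the boundary layer. -/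
theorem IncSol.neg_U_zero_mul_le (h : IncSol N R A B p q g ε U) {τ : ℝ} (hτ : 0 < τ)
    (hτ1 : τ ≤ 1) (hτR : τ ≤ R) :
    -U 0 * (R ^ N / N) ≤ R ^ N / N * (U (R - τ) - U 0) +
      τ * ((R ^ N / N * A / (B * Real.exp (q * lowerBound A B p))) / p +
        R ^ (N - 1) * (Real.log (1 / τ) / p - lowerBound A B p)) := by
  have hR := h.par.R_pos
  have hp := h.par.p_pos
  set l := lowerBound A B p with hl
  have hU0 := h.U_zero_nonpos
  have hl0 : l ≤ U 0 := h.lowerBound_le_zero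
  have hlog : 0 ≤ Real.log (1 / τ) := Real.log_nonneg (by rw [le_div_iff₀ hτ]; linarith)
  set K := Real.log (1 / τ) / p - l with hK
  have hK0 : 0 ≤ K := by
    have : 0 ≤ Real.log (1 / τ) / p := by positivity
    linarith
  set d := U (R - τ) - U 0 with hd
  have hRτ : R - τ ∈ Icc 0 R := ⟨by linarith, by linarith⟩
  have hd0 : 0 ≤ d := sub_nonneg.2 (h.monotoneOn (left_mem_Icc.2 hR.le) hRτ hRτ.1)
  -- In the layer `U` may be large. Subtracting `(τ/p) e^(pU)` leaves at most `log(1/τ)/p - U(0)`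
  -- pointwise, while the subtracted term costs only `O(τ)` because the integral of `s^(N-1) e^(pU)`
  -- is bounded uniformly.
  set ψ : ℝ → ℝ := fun s => s ^ (N - 1) * (U s - U 0 - τ / p * Real.exp (p * U s)) with hψ
  have hψc : ContinuousOn ψ (Icc 0 R) := by
    refine (continuous_pow _).continuousOn.mul ((h.continuousOn.sub continuousOn_const).sub
      (continuousOn_const.mul (Real.continuous_exp.comp_continuousOn
        (continuousOn_const.mul h.continuousOn))))
  have i1 : IntervalIntegrable ψ MeasureTheory.volume 0 (R - τ) := by
    apply ContinuousOn.intervalIntegrable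
    rw [uIcc_of_le hRτ.1]
    exact hψc.mono (Icc_subset_Icc le_rfl hRτ.2)
  have i2 : IntervalIntegrable ψ MeasureTheory.volume (R - τ) R := by
    apply ContinuousOn.intervalIntegrable
    rw [uIcc_of_le hRτ.2]
    exact hψc.mono (Icc_subset_Icc hRτ.1 le_rfl)
  have hsplit := intervalIntegral.integral_add_adjacent_intervals i1 i2
  have e1 : ∫ s in (0 : ℝ)..R, ψ s = -U 0 * (R ^ N / N) -
      τ / p * ∫ s in (0 : ℝ)..R, s ^ (N - 1) * Real.exp (p * U s) := by
    have : ψ = fun s => (s ^ (N - 1) * U s - U 0 * s ^ (N - 1)) -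
        τ / p * (s ^ (N - 1) * Real.exp (p * U s)) := by
      funext s; rw [hψ]; ring
    rw [this]
    have j : IntervalIntegrable (fun s : ℝ => U 0 * s ^ (N - 1)) MeasureTheory.volume 0 R :=
      (by fun_prop : Continuous fun s : ℝ => U 0 * s ^ (N - 1)).intervalIntegrable _ _
    rw [intervalIntegral.integral_sub (h.integrable_pow_mul.sub j)
        ((h.integrable_exp p).const_mul _),
      intervalIntegral.integral_sub h.integrable_pow_mul j, h.sol.mean_zero,
      intervalIntegral.integral_const_mul, intervalIntegral.integral_const_mul, h.par.integral_pow]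
    ring
  have e2 : ∫ s in (0 : ℝ)..(R - τ), ψ s ≤ R ^ N / N * d := by
    have : ∫ s in (0 : ℝ)..(R - τ), ψ s ≤ ∫ s in (0 : ℝ)..(R - τ), s ^ (N - 1) * d := by
      refine intervalIntegral.integral_mono_on hRτ.1 i1
        ((by fun_prop : Continuous fun s : ℝ => s ^ (N - 1) * d).intervalIntegrable _ _)
        fun s hs => ?_
      refine mul_le_mul_of_nonneg_left ?_ (pow_nonneg hs.1 _)
      have b1 := h.monotoneOn ⟨hs.1, hs.2.trans hRτ.2⟩ hRτ hs.2
      have b2 : 0 ≤ τ / p * Real.exp (p * U s) := by positivity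
      linarith
    refine this.trans ?_
    rw [intervalIntegral.integral_mul_const]
    refine mul_le_mul_of_nonneg_right ?_ hd0
    rw [← h.par.integral_pow]
    refine intervalIntegral.integral_mono_interval le_rfl hRτ.1 hRτ.2 ?_
      ((continuous_pow _).intervalIntegrable _ _)
    filter_upwards [MeasureTheory.self_mem_ae_restrict measurableSet_Ioc] with s hs
    exact pow_nonneg hs.1.le _
  have e3 : ∫ s in (R - τ)..R, ψ s ≤ τ * (R ^ (N - 1) * K) := by
    have : ∫ s in (R - τ)..R, ψ s ≤ ∫ _ in (R - τ)..R, R ^ (N - 1) * K := by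
      refine intervalIntegral.integral_mono_on hRτ.2 i2 intervalIntegrable_const fun s hs => ?_
      have hs0 : 0 ≤ s := hRτ.1.trans hs.1
      -- This is `x + 1 ≤ e^x` at `x = p U + log τ`.
      have b1 : p * U s ≤ τ * Real.exp (p * U s) + Real.log (1 / τ) := by
        have := Real.add_one_le_exp (p * U s + Real.log τ)
        rw [Real.exp_add, Real.exp_log hτ] at this
        rw [one_div, Real.log_inv]
        linarith
      have b2 : U s ≤ τ / p * Real.exp (p * U s) + Real.log (1 / τ) / p := by
        have e : τ / p * Real.exp (p * U s) + Real.log (1 / τ) / p =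
          (τ * Real.exp (p * U s) + Real.log (1 / τ)) / p := by ring
        rw [e, le_div_iff₀ hp]; linarith
      calc ψ s ≤ s ^ (N - 1) * K :=
            mul_le_mul_of_nonneg_left (by linarith) (pow_nonneg hs0 _)
        _ ≤ _ := mul_le_mul_of_nonneg_right (pow_le_pow_left₀ hs0 hs.2 _) hK0
    refine this.trans (le_of_eq ?_)
    rw [intervalIntegral.integral_const, smul_eq_mul]
    ring
  have e4 : τ / p * ∫ s in (0 : ℝ)..R, s ^ (N - 1) * Real.exp (p * U s) ≤
      τ * ((R ^ N / N * A / (B * Real.exp (q * l))) / p) := by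
    have := mul_le_mul_of_nonneg_left h.integral_exp_le (by positivity : 0 ≤ τ / p)
    refine this.trans (le_of_eq ?_)
    ring
  rw [e1] at hsplit
  rw [mul_add]
  linarith

end Estimates

/-! ### Elementary limits as `ε ↓ 0`. -/

theorem tendsto_rpow_nhdsGT_zero {κ : ℝ} (hκ : 0 < κ) :
    Tendsto (fun ε : ℝ => ε ^ κ) (𝓝[>] 0) (𝓝 0) := by
  have h := (Real.continuousAt_rpow_const 0 κ (Or.inr hκ.le)).tendsto
  rw [Real.zero_rpow hκ.ne'] at h
  exact h.mono_left nhdsWithin_le_nhds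

theorem eventually_pos_nhdsGT_zero : ∀ᶠ ε : ℝ in 𝓝[>] 0, 0 < ε := self_mem_nhdsWithin

theorem eventually_lt_nhdsGT_zero {a : ℝ} (ha : 0 < a) : ∀ᶠ ε : ℝ in 𝓝[>] 0, ε < a :=
  nhdsWithin_le_nhds (Iio_mem_nhds ha)

/-- Halving the exponential rate absorbs any constant and any negative power of `ε`. -/
theorem eventually_div_pow_mul_exp_le {κ c : ℝ} (hκ : κ < 1) (hc : 0 < c) (K : ℝ) (n : ℕ) :
    ∀ᶠ ε : ℝ in 𝓝[>] 0,
      K / ε ^ n * Real.exp (-(c / ε ^ (1 - κ))) ≤ Real.exp (-(c / 2 / ε ^ (1 - κ))) := by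
  have hκ' : 0 < 1 - κ := sub_pos.2 hκ
  have h1 : Tendsto (fun ε : ℝ => (ε ^ (1 - κ))⁻¹) (𝓝[>] 0) atTop := by
    refine tendsto_inv_nhdsGT_zero.comp (tendsto_nhdsWithin_iff.2
      ⟨tendsto_rpow_nhdsGT_zero hκ', ?_⟩)
    filter_upwards [eventually_pos_nhdsGT_zero] with ε hε using Real.rpow_pos_of_pos hε _
  have h2 := ((tendsto_rpow_mul_exp_neg_mul_atTop_nhds_zero (n / (1 - κ)) (c / 2)
    (by positivity)).comp h1).const_mul K
  rw [mul_zero] at h2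
  filter_upwards [h2.eventually_le_const one_pos, eventually_pos_nhdsGT_zero] with ε h3 hε
  simp only [Function.comp] at h3
  have e1 : ((ε ^ (1 - κ))⁻¹) ^ ((n : ℝ) / (1 - κ)) = (ε ^ n)⁻¹ := by
    rw [Real.inv_rpow (Real.rpow_nonneg hε.le _), ← Real.rpow_mul hε.le,
      mul_div_cancel₀ _ hκ'.ne', Real.rpow_natCast]
  rw [e1] at h3
  have e2 : Real.exp (-(c / ε ^ (1 - κ))) =
      Real.exp (-(c / 2) * (ε ^ (1 - κ))⁻¹) * Real.exp (-(c / 2 / ε ^ (1 - κ))) := by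
    rw [← Real.exp_add]; congr 1; ring
  rw [e2]
  calc _ = K * ((ε ^ n)⁻¹ * Real.exp (-(c / 2) * (ε ^ (1 - κ))⁻¹)) *
        Real.exp (-(c / 2 / ε ^ (1 - κ))) := by ring
    _ ≤ 1 * Real.exp (-(c / 2 / ε ^ (1 - κ))) :=
        mul_le_mul_of_nonneg_right h3 (Real.exp_pos _).le
    _ = _ := one_mul _

/-! ### Interior estimates and limits of the nonlocal coefficients. -/

section Interior

variable {N : ℕ} {R A B p q : ℝ} {g : ℝ → ℝ} {U : ℝ → ℝ → ℝ}

/-- Flux and charge density are exponentially small at distance `ε^κ` from the boundary. -/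
theorem exists_eventually_interior_decay (P : Params N R A B p q g)
    (hU : ∀ ε : ℝ, 0 < ε → IncSol N R A B p q g ε (U ε)) {κ : ℝ} (hκ : κ ∈ Ioo (0 : ℝ) 1) :
    ∃ M > 0, ∀ K : ℝ, 0 < K → ∀ᶠ ε : ℝ in 𝓝[>] 0,
      K / ε ^ 2 * (flux N R g (U ε) (R - ε ^ κ) +
        reaction N R A B p q (U ε) (U ε (R - ε ^ κ))) ≤ Real.exp (-(M / ε ^ (1 - κ))) := by
  obtain ⟨c, hc, μ, hμ, hdec⟩ := P.exists_decay
  have hR := P.R_pos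
  set J := R ^ N / N * (A - B) with hJ
  have hJ0 : 0 < J := mul_pos P.vol_pos (sub_pos.2 P.B_lt_A)
  set c2 := (R / 2) ^ (N - 1) with hc2
  have hc2' : 0 < c2 := by positivity
  -- One factor `1/2` comes from running the decay over half of the layer only, the other from
  -- absorbing powers of `ε`. The power `ε⁻⁴` below combines the prefactor `ε⁻²` with the size `ε⁻²`
  -- of the flux.
  refine ⟨c / 2 / 2, by positivity, fun K hK => ?_⟩
  filter_upwards [eventually_div_pow_mul_exp_le hκ.2 (half_pos hc)
      (K * (1 + 1 / μ) * (J + μ * (2 * J / c2))) 4, eventually_pos_nhdsGT_zero,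
    eventually_lt_nhdsGT_zero one_pos,
    (tendsto_rpow_nhdsGT_zero hκ.1).eventually_le_const (half_pos hR)] with ε hE hε hε1 hτ
  have h := hU ε hε
  set τ := ε ^ κ with hτd
  have hτ0 : 0 < τ := Real.rpow_pos_of_pos hε _
  have hετ : ε ≤ τ := by
    have := Real.rpow_le_rpow_of_exponent_ge hε hε1.le hκ.2.le
    rwa [Real.rpow_one] at this
  -- The decay starts at `R - τ/2` rather than at `R`, because the `O(1/t)` bound on the reaction
  -- degenerates at the boundary.
  have h1 := hdec ε (U ε) h (R - τ) (R - τ / 2) (by linarith) (by linarith) (by linarith)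
  have hexp : Real.exp (-(c / ε) * (R - τ / 2 - (R - τ))) =
      Real.exp (-(c / 2 / ε ^ (1 - κ))) := by
    congr 1
    have : ε ^ (1 - κ) = ε / τ := by rw [Real.rpow_sub hε, Real.rpow_one]
    rw [this]
    field_simp
    ring
  rw [hexp] at h1
  have hs : R - τ / 2 ∈ Icc 0 R := ⟨by linarith, by linarith⟩
  have hr : R - τ ∈ Icc 0 R := ⟨by linarith, by linarith⟩
  have h2 : flux N R g (U ε) (R - τ / 2) ≤ J / ε ^ 2 := by
    rw [hJ, ← h.flux_right]
    exact h.flux_monotoneOn hs (right_mem_Icc.2 hR.le) hs.2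
  have h3 : reaction N R A B p q (U ε) (U ε (R - τ / 2)) ≤ 2 * J / c2 / ε := by
    have h4 := h.reaction_mul_le (r := R - τ / 2) (by linarith) (by linarith)
    have h5 : R - (R - τ / 2) = τ / 2 := by ring
    rw [h5, ← hJ] at h4
    have h0 := h.reaction_nonneg hs
    rw [le_div_iff₀ hε, le_div_iff₀ hc2']
    have := mul_le_mul_of_nonneg_left hετ (mul_nonneg h0 hc2'.le)
    nlinarith
  have h6 : flux N R g (U ε) (R - τ / 2) +
      μ / ε * reaction N R A B p q (U ε) (U ε (R - τ / 2)) ≤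
      (J + μ * (2 * J / c2)) / ε ^ 2 := by
    have := mul_le_mul_of_nonneg_left h3 (by positivity : 0 ≤ μ / ε)
    have e : (J + μ * (2 * J / c2)) / ε ^ 2 = J / ε ^ 2 + μ / ε * (2 * J / c2 / ε) := by
      field_simp
    rw [e]; linarith
  have hw := h.flux_nonneg hr
  have hre := h.reaction_nonneg hr
  set w := flux N R g (U ε) (R - τ)
  set f := reaction N R A B p q (U ε) (U ε (R - τ))
  have h7 : w + f ≤ (1 + 1 / μ) * (w + μ / ε * f) := by
    have a1 : f ≤ 1 / ε * f := by
      have : 1 ≤ 1 / ε := by rw [le_div_iff₀ hε]; linarith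
      nlinarith
    have e : (1 + 1 / μ) * (w + μ / ε * f) = w + 1 / μ * w + μ / ε * f + 1 / ε * f := by
      field_simp
      ring
    have a2 : 0 ≤ 1 / μ * w := by positivity
    have a3 : 0 ≤ μ / ε * f := by positivity
    rw [e]; linarith
  have h8 := h1.trans (mul_le_mul_of_nonneg_left h6 (Real.exp_pos _).le)
  calc K / ε ^ 2 * (w + f) ≤ K / ε ^ 2 * ((1 + 1 / μ) * (Real.exp (-(c / 2 / ε ^ (1 - κ))) *
        ((J + μ * (2 * J / c2)) / ε ^ 2))) := by
        refine mul_le_mul_of_nonneg_left (h7.trans ?_) (by positivity)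
        exact mul_le_mul_of_nonneg_left h8 (by positivity)
    _ = K * (1 + 1 / μ) * (J + μ * (2 * J / c2)) / ε ^ 4 *
        Real.exp (-(c / 2 / ε ^ (1 - κ))) := by
        field_simp
    _ ≤ _ := hE

-- By the interior decay, `U(R - τ) - U(0) ≤ τ` with `τ = ε^κ`. The zero mean then bounds `-U(0)`,
-- and monotonicity traps `U` between these values. The derivative estimate follows from
-- monotonicity of the flux.
set_option maxHeartbeats 1000000 in
theorem exists_eventually_interior_bound (P : Params N R A B p q g)
    (hU : ∀ ε : ℝ, 0 < ε → IncSol N R A B p q g ε (U ε)) {κ : ℝ} (hκ : κ ∈ Ioo (0 : ℝ) 1) :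
    ∃ C > (0 : ℝ), ∃ M > (0 : ℝ), ∀ᶠ ε : ℝ in 𝓝[>] 0, ∀ r ∈ Icc 0 (R - ε ^ κ),
      |U ε r| ≤ C * ε ^ κ * Real.log (1 / ε) ∧
      r ^ (N - 1) * |D R (U ε) r| ≤ Real.exp (-(M / ε ^ (1 - κ))) := by
  obtain ⟨m, hm, _, _, hgm⟩ := P.exists_g_bounds
  obtain ⟨M, hM, hdec⟩ := exists_eventually_interior_decay P hU hκ
  have hR := P.R_pos
  have hN := P.N_pos
  have hp := P.p_pos
  have hA := P.A_pos
  have hB := P.B_pos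
  have hI := P.vol_pos
  set I := R ^ N / N with hId
  set l := lowerBound A B p with hl
  have hl0 : l ≤ 0 := (hU 1 one_pos).lowerBound_le_zero.trans (hU 1 one_pos).U_zero_nonpos
  set C1 := I * A / (B * Real.exp (q * l)) / p with hC1
  have hC1' : 0 < C1 := by positivity
  set C2 := C1 + R ^ (N - 1) * (1 / p - l) with hC2
  have hC2' : 0 < C2 := by
    have : 0 ≤ R ^ (N - 1) * (1 / p - l) := by
      have : 0 ≤ 1 / p := by positivity
      exact mul_nonneg (by positivity) (by linarith)
    linarith
  refine ⟨1 + C2 / I, by positivity, M, hM, ?_⟩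
  filter_upwards [hdec (1 / m) (by positivity), hdec (R ^ 2 / (N * m)) (by positivity),
    eventually_div_pow_mul_exp_le hκ.2 hM 1 1, eventually_pos_nhdsGT_zero,
    -- `ε < e⁻¹` makes `log(1/ε) ≥ 1`, so constant terms can be absorbed into the logarithm.
    eventually_lt_nhdsGT_zero (Real.exp_pos (-1)),
    (tendsto_rpow_nhdsGT_zero hκ.1).eventually_le_const (half_pos hR)] with
    ε hd1 hd2 hd3 hε hεe hτ r hr
  have h := hU ε hε
  have hε1 : ε ≤ 1 := hεe.le.trans (Real.exp_le_one_iff.2 (by norm_num))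
  set τ := ε ^ κ with hτd
  have hτ0 : 0 < τ := Real.rpow_pos_of_pos hε _
  have hτ1 : τ ≤ 1 := Real.rpow_le_one hε.le hε1 hκ.1.le
  have hετ : ε ≤ τ := by
    have := Real.rpow_le_rpow_of_exponent_ge hε hε1 hκ.2.le
    rwa [Real.rpow_one] at this
  set Λ := Real.log (1 / ε) with hΛ
  have hΛ1 : 1 ≤ Λ := by
    rw [hΛ, one_div, Real.log_inv]
    have := (Real.log_lt_iff_lt_exp hε).2 hεe
    linarith
  have hΛτ : Real.log (1 / τ) ≤ Λ := by
    rw [hΛ]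
    exact Real.log_le_log (by positivity) (one_div_le_one_div_of_le hε hετ)
  have hRτ : R - τ ∈ Icc 0 R := ⟨by linarith, by linarith⟩
  have hrR : r ∈ Icc 0 R := ⟨hr.1, hr.2.trans hRτ.2⟩
  have hw := h.flux_nonneg hRτ
  have hf := h.reaction_nonneg hRτ
  have hε2 : ε ^ 2 ≤ 1 := pow_le_one₀ hε.le hε1
  constructor
  · have hd : U ε (R - τ) - U ε 0 ≤ τ := by
      have a1 := h.U_sub_U_zero_le hm (fun r hr => (hgm r hr).1) hRτ
      have a2 : R ^ 2 / (N * m) * (reaction N R A B p q (U ε) (U ε (R - τ)) / ε ^ 2) ≤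
          R ^ 2 / (N * m) / ε ^ 2 * (flux N R g (U ε) (R - τ) +
            reaction N R A B p q (U ε) (U ε (R - τ))) := by
        have e : R ^ 2 / (N * m) * (reaction N R A B p q (U ε) (U ε (R - τ)) / ε ^ 2) =
          R ^ 2 / (N * m) / ε ^ 2 * reaction N R A B p q (U ε) (U ε (R - τ)) := by ring
        rw [e]
        exact mul_le_mul_of_nonneg_left (by linarith) (by positivity)
      have a3 : Real.exp (-(M / ε ^ (1 - κ))) ≤ ε := by
        have b1 : Real.exp (-(M / 2 / ε ^ (1 - κ))) ≤ 1 := by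
          rw [Real.exp_le_one_iff]
          have := Real.rpow_pos_of_pos hε (1 - κ)
          have : 0 < M / 2 / ε ^ (1 - κ) := by positivity
          linarith
        have b2 := hd3.trans b1
        rw [pow_one, div_mul_eq_mul_div, one_mul, div_le_iff₀ hε] at b2
        linarith
      linarith
    have hm0 := h.neg_U_zero_mul_le hτ0 hτ1 (by linarith)
    rw [← hl, ← hC1, ← hId] at hm0
    have b1 : C1 + R ^ (N - 1) * (Real.log (1 / τ) / p - l) ≤ C2 * Λ := by
      have b2 : Real.log (1 / τ) / p - l ≤ (1 / p - l) * Λ := by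
        have : Real.log (1 / τ) / p ≤ Λ / p := by gcongr
        have e : (1 / p - l) * Λ = Λ / p + -l * Λ := by ring
        rw [e]; nlinarith
      have b3 := mul_le_mul_of_nonneg_left b2 (by positivity : 0 ≤ R ^ (N - 1))
      have b4 : C1 ≤ C1 * Λ := by nlinarith
      have e : C2 * Λ = C1 * Λ + R ^ (N - 1) * ((1 / p - l) * Λ) := by rw [hC2]; ring
      rw [e]; linarith
    have hτΛ : τ ≤ τ * Λ := by nlinarith
    have b5 : -U ε 0 ≤ (1 + C2 / I) * τ * Λ := by
      have b6 : -U ε 0 * I ≤ I * (τ * Λ) + τ * (C2 * Λ) := by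
        have := mul_le_mul_of_nonneg_left (hd.trans hτΛ) hI.le
        have := mul_le_mul_of_nonneg_left b1 hτ0.le
        linarith
      have e : I * (τ * Λ) + τ * (C2 * Λ) = (1 + C2 / I) * τ * Λ * I := by field_simp
      rw [e] at b6
      exact le_of_mul_le_mul_right b6 hI
    have b7 : τ * Λ ≤ (1 + C2 / I) * τ * Λ := by
      have : 0 ≤ C2 / I * (τ * Λ) := by positivity
      linarith
    have b8 := h.monotoneOn (left_mem_Icc.2 hR.le) hrR hr.1
    have b9 := h.monotoneOn hrR hRτ hr.2
    have b10 := h.U_zero_nonpos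
    rw [abs_le]
    constructor <;> linarith
  · have a1 := h.flux_monotoneOn hrR hRτ hr.2
    have hV := h.D_nonneg hrR
    rw [abs_of_nonneg hV]
    have a2 : m * (r ^ (N - 1) * D R (U ε) r) ≤ flux N R g (U ε) r := by
      have := mul_le_mul_of_nonneg_right (hgm r hrR).1 (mul_nonneg (pow_nonneg hr.1 (N - 1)) hV)
      unfold flux
      linarith
    have a3 : r ^ (N - 1) * D R (U ε) r ≤ 1 / m * flux N R g (U ε) (R - τ) := by
      rw [one_div, ← div_eq_inv_mul, le_div_iff₀ hm]
      linarith
    refine a3.trans (le_trans ?_ hd1)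
    have a4 : 1 / m ≤ 1 / m / ε ^ 2 := by
      rw [le_div_iff₀ (by positivity)]
      have : 0 < 1 / m := by positivity
      nlinarith
    exact mul_le_mul a4 (by linarith) hw (by positivity)

theorem tendsto_mul_rpow_mul_log (C : ℝ) :
    Tendsto (fun ε : ℝ => C * ε ^ (1 / 2 : ℝ) * Real.log (1 / ε)) (𝓝[>] 0) (𝓝 0) := by
  have h := (tendsto_log_mul_rpow_nhdsGT_zero (by norm_num : (0 : ℝ) < 1 / 2)).const_mul (-C)
  rw [mul_zero] at h
  refine h.congr fun ε => ?_
  rw [one_div ε, Real.log_inv]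
  ring

theorem eventually_layer_le (hR : 0 < R) : ∀ᶠ ε : ℝ in 𝓝[>] 0, ε ^ (1 / 2 : ℝ) ≤ R / 2 :=
  (tendsto_rpow_nhdsGT_zero (by norm_num)).eventually_le_const (half_pos hR)

/-- The choice `κ = 1/2` fixes a reference point `R - √ε`: it tends to `R`, yet lies outside the
boundary layer, so `U`, flux and reaction all vanish there in the limit. -/
theorem tendsto_U_layer (P : Params N R A B p q g)
    (hU : ∀ ε : ℝ, 0 < ε → IncSol N R A B p q g ε (U ε)) :
    Tendsto (fun ε => U ε (R - ε ^ (1 / 2 : ℝ))) (𝓝[>] 0) (𝓝 0) := by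
  obtain ⟨C, _, M, _, h⟩ := exists_eventually_interior_bound P hU
    (κ := 1 / 2) ⟨by norm_num, by norm_num⟩
  refine squeeze_zero_norm' ?_ (tendsto_mul_rpow_mul_log C)
  filter_upwards [h, eventually_layer_le P.R_pos] with ε h1 h2
  exact (h1 _ ⟨by linarith [P.R_pos], le_rfl⟩).1

theorem tendsto_U_zero (P : Params N R A B p q g)
    (hU : ∀ ε : ℝ, 0 < ε → IncSol N R A B p q g ε (U ε)) :
    Tendsto (fun ε => U ε 0) (𝓝[>] 0) (𝓝 0) := by
  obtain ⟨C, _, M, _, h⟩ := exists_eventually_interior_bound P hU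
    (κ := 1 / 2) ⟨by norm_num, by norm_num⟩
  refine squeeze_zero_norm' ?_ (tendsto_mul_rpow_mul_log C)
  filter_upwards [h, eventually_layer_le P.R_pos] with ε h1 h2
  exact (h1 _ ⟨le_rfl, by linarith [P.R_pos]⟩).1

theorem tendsto_exp_neg_div_rpow {M a : ℝ} (hM : 0 < M) (ha : 0 < a) :
    Tendsto (fun ε : ℝ => Real.exp (-(M / ε ^ a))) (𝓝[>] 0) (𝓝 0) := by
  refine Real.tendsto_exp_atBot.comp (tendsto_neg_atTop_atBot.comp ?_)
  refine Tendsto.const_mul_atTop hM (tendsto_inv_nhdsGT_zero.comp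
    (tendsto_nhdsWithin_iff.2 ⟨tendsto_rpow_nhdsGT_zero ha, ?_⟩))
  filter_upwards [eventually_pos_nhdsGT_zero] with ε hε using Real.rpow_pos_of_pos hε _

theorem tendsto_flux_add_reaction_layer (P : Params N R A B p q g)
    (hU : ∀ ε : ℝ, 0 < ε → IncSol N R A B p q g ε (U ε)) :
    Tendsto (fun ε => flux N R g (U ε) (R - ε ^ (1 / 2 : ℝ)) +
      reaction N R A B p q (U ε) (U ε (R - ε ^ (1 / 2 : ℝ)))) (𝓝[>] 0) (𝓝 0) := by
  obtain ⟨M, hM, h⟩ := exists_eventually_interior_decay P hU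
    (κ := 1 / 2) ⟨by norm_num, by norm_num⟩
  refine squeeze_zero' ?_ ?_ (tendsto_exp_neg_div_rpow hM (by norm_num : (0 : ℝ) < 1 - 1 / 2))
  · filter_upwards [eventually_pos_nhdsGT_zero, eventually_layer_le P.R_pos] with ε hε h2
    have hm : R - ε ^ (1 / 2 : ℝ) ∈ Icc 0 R :=
      ⟨by linarith [P.R_pos], by linarith [Real.rpow_nonneg hε.le (1 / 2)]⟩
    exact add_nonneg ((hU ε hε).flux_nonneg hm) ((hU ε hε).reaction_nonneg hm)
  · filter_upwards [eventually_pos_nhdsGT_zero, eventually_layer_le P.R_pos, h 1 one_pos,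
      eventually_lt_nhdsGT_zero one_pos] with ε hε h2 h3 h4
    have hm : R - ε ^ (1 / 2 : ℝ) ∈ Icc 0 R :=
      ⟨by linarith [P.R_pos], by linarith [Real.rpow_nonneg hε.le (1 / 2)]⟩
    refine le_trans ?_ h3
    refine le_mul_of_one_le_left
      (add_nonneg ((hU ε hε).flux_nonneg hm) ((hU ε hε).reaction_nonneg hm)) ?_
    rw [le_div_iff₀ (by positivity), one_mul]
    exact pow_le_one₀ hε.le h4.le

theorem tendsto_flux_layer (P : Params N R A B p q g)
    (hU : ∀ ε : ℝ, 0 < ε → IncSol N R A B p q g ε (U ε)) :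
    Tendsto (fun ε => flux N R g (U ε) (R - ε ^ (1 / 2 : ℝ))) (𝓝[>] 0) (𝓝 0) := by
  refine squeeze_zero' ?_ ?_ (tendsto_flux_add_reaction_layer P hU)
  all_goals
    filter_upwards [eventually_pos_nhdsGT_zero, eventually_layer_le P.R_pos] with ε hε h2
    have hm : R - ε ^ (1 / 2 : ℝ) ∈ Icc 0 R :=
      ⟨by linarith [P.R_pos], by linarith [Real.rpow_nonneg hε.le (1 / 2)]⟩
  · exact (hU ε hε).flux_nonneg hm
  · exact le_add_of_nonneg_right ((hU ε hε).reaction_nonneg hm)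

theorem tendsto_reaction_zero (P : Params N R A B p q g)
    (hU : ∀ ε : ℝ, 0 < ε → IncSol N R A B p q g ε (U ε)) :
    Tendsto (fun ε => reaction N R A B p q (U ε) (U ε 0)) (𝓝[>] 0) (𝓝 0) := by
  refine squeeze_zero' ?_ ?_ (tendsto_flux_add_reaction_layer P hU)
  all_goals
    filter_upwards [eventually_pos_nhdsGT_zero, eventually_layer_le P.R_pos] with ε hε h2
    have hm : R - ε ^ (1 / 2 : ℝ) ∈ Icc 0 R :=
      ⟨by linarith [P.R_pos], by linarith [Real.rpow_nonneg hε.le (1 / 2)]⟩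
  · exact (hU ε hε).reaction_nonneg (left_mem_Icc.2 P.R_pos.le)
  · exact ((hU ε hε).reaction_mono le_rfl hm.1 hm.2).trans
      (le_add_of_nonneg_left ((hU ε hε).flux_nonneg hm))

theorem tendsto_coef_neg (P : Params N R A B p q g)
    (hU : ∀ ε : ℝ, 0 < ε → IncSol N R A B p q g ε (U ε)) :
    Tendsto (fun ε => coef N R B (-q) (U ε)) (𝓝[>] 0) (𝓝 B) := by
  have h1 : Tendsto (fun ε => B * Real.exp (q * U ε 0)) (𝓝[>] 0) (𝓝 B) := by
    have := ((Real.continuous_exp.tendsto _).comp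
      ((tendsto_U_zero P hU).const_mul q)).const_mul B
    simpa using this
  refine tendsto_of_tendsto_of_tendsto_of_le_of_le' h1 tendsto_const_nhds ?_ ?_
  · filter_upwards [eventually_pos_nhdsGT_zero] with ε hε using (hU ε hε).le_coef_neg
  · filter_upwards [eventually_pos_nhdsGT_zero] with ε hε using (hU ε hε).coef_le P.B_pos _

/-- The limit is `B`, not `A`: as the reaction at `0` tends to zero and `U(0) → 0`, the two
coefficients must balance. The surplus `A - B` is carried by the boundary layer. -/
theorem tendsto_coef (P : Params N R A B p q g)
    (hU : ∀ ε : ℝ, 0 < ε → IncSol N R A B p q g ε (U ε)) :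
    Tendsto (fun ε => coef N R A p (U ε)) (𝓝[>] 0) (𝓝 B) := by
  have h0 := tendsto_U_zero P hU
  have h1 : Tendsto (fun ε => Real.exp (-q * U ε 0)) (𝓝[>] 0) (𝓝 1) := by
    simpa [Function.comp_def] using (Real.continuous_exp.tendsto _).comp (h0.const_mul (-q))
  have h2 : Tendsto (fun ε => Real.exp (-(p * U ε 0))) (𝓝[>] 0) (𝓝 1) := by
    simpa [Function.comp_def] using (Real.continuous_exp.tendsto _).comp (h0.const_mul p).neg
  have h3 := ((tendsto_reaction_zero P hU).add ((tendsto_coef_neg P hU).mul h1)).mul h2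
  simp only [zero_add, mul_one] at h3
  refine h3.congr fun ε => ?_
  unfold reaction
  rw [sub_add_cancel, mul_assoc, ← Real.exp_add]
  simp

end Interior

/-! ### Energy identity and a priori bounds for `e^(-pU/2)`. -/

/-- A primitive of the nonlinearity. -/
noncomputable def potential (N : ℕ) (R A B p q : ℝ) (U : ℝ → ℝ) (u : ℝ) : ℝ :=
  coef N R A p U / p * Real.exp (p * u) + coef N R B (-q) U / q * Real.exp (-q * u)

section Energy

variable {N : ℕ} {R A B p q ε : ℝ} {g U : ℝ → ℝ}

theorem IncSol.hasDerivAt_potential (h : IncSol N R A B p q g ε U) (u : ℝ) :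
    HasDerivAt (potential N R A B p q U) (reaction N R A B p q U u) u := by
  have hp := h.par.p_pos.ne'
  have hq := h.par.q_pos.ne'
  have h1 : HasDerivAt (fun u => Real.exp (p * u)) (Real.exp (p * u) * (p * 1)) u :=
    ((hasDerivAt_id u).const_mul p).exp
  have h2 : HasDerivAt (fun u => Real.exp (-q * u)) (Real.exp (-q * u) * (-q * 1)) u :=
    ((hasDerivAt_id u).const_mul (-q)).exp
  refine ((h1.const_mul (coef N R A p U / p)).add
    (h2.const_mul (coef N R B (-q) U / q))).congr_deriv ?_
  unfold reaction
  field_simp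
  ring

theorem IncSol.continuousOn_potential (h : IncSol N R A B p q g ε U) :
    ContinuousOn (fun r => potential N R A B p q U (U r)) (Icc 0 R) := by
  have : Continuous (potential N R A B p q U) := by unfold potential; fun_prop
  exact this.comp_continuousOn h.continuousOn

theorem IncSol.hasDerivAt_flux_sq (h : IncSol N R A B p q g ε U) {x : ℝ} (hx : x ∈ Ioo 0 R) :
    HasDerivAt (fun x => ε ^ 2 / 2 * flux N R g U x ^ 2)
      ((x ^ (N - 1)) ^ 2 * g x * (reaction N R A B p q U (U x) * D R U x)) x := by
  refine (((h.hasDerivAt_flux hx).pow 2).const_mul (ε ^ 2 / 2)).congr_deriv ?_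
  have := h.eps_pos.ne'
  unfold flux
  field_simp
  push_cast
  ring

/-- Together with `IncSol.le_mul_potential_sub`, this integrates the energy identity with the weight
`x^(2(N-1)) g` frozen at a constant, which is legitimate because `f(U) U' ≥ 0`. -/
theorem IncSol.mul_potential_sub_le (h : IncSol N R A B p q g ε U) {s r lo : ℝ} (hs : 0 ≤ s)
    (hsr : s ≤ r) (hr : r ≤ R) (hlo : ∀ x ∈ Icc s r, lo ≤ (x ^ (N - 1)) ^ 2 * g x) :
    lo * (potential N R A B p q U (U r) - potential N R A B p q U (U s)) ≤
      ε ^ 2 / 2 * flux N R g U r ^ 2 - ε ^ 2 / 2 * flux N R g U s ^ 2 := by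
  have key := le_of_hasDerivAt_nonneg
    (f := fun x => ε ^ 2 / 2 * flux N R g U x ^ 2 - lo * potential N R A B p q U (U x)) hsr
    (((continuousOn_const.mul (h.continuousOn_flux.pow 2)).sub
      (continuousOn_const.mul h.continuousOn_potential)).mono (Icc_subset_Icc hs hr))
    (fun x hx => (h.hasDerivAt_flux_sq ⟨hs.trans_lt hx.1, hx.2.trans_le hr⟩).sub
      (((h.hasDerivAt_potential (U x)).comp x
        (h.hasDerivAt ⟨hs.trans_lt hx.1, hx.2.trans_le hr⟩)).const_mul lo)) (fun x hx => by
      have hx' : x ∈ Icc 0 R := ⟨hs.trans hx.1.le, hx.2.le.trans hr⟩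
      rw [← sub_mul]
      exact mul_nonneg (sub_nonneg.2 (hlo x (Ioo_subset_Icc_self hx)))
        (mul_nonneg (h.reaction_nonneg hx') (h.D_nonneg hx')))
  linarith

theorem IncSol.le_mul_potential_sub (h : IncSol N R A B p q g ε U) {s r hi : ℝ} (hs : 0 ≤ s)
    (hsr : s ≤ r) (hr : r ≤ R) (hhi : ∀ x ∈ Icc s r, (x ^ (N - 1)) ^ 2 * g x ≤ hi) :
    ε ^ 2 / 2 * flux N R g U r ^ 2 - ε ^ 2 / 2 * flux N R g U s ^ 2 ≤
      hi * (potential N R A B p q U (U r) - potential N R A B p q U (U s)) := by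
  have key := le_of_hasDerivAt_nonneg
    (f := fun x => hi * potential N R A B p q U (U x) - ε ^ 2 / 2 * flux N R g U x ^ 2) hsr
    (((continuousOn_const.mul h.continuousOn_potential).sub
      (continuousOn_const.mul (h.continuousOn_flux.pow 2))).mono (Icc_subset_Icc hs hr))
    (fun x hx => (((h.hasDerivAt_potential (U x)).comp x
        (h.hasDerivAt ⟨hs.trans_lt hx.1, hx.2.trans_le hr⟩)).const_mul hi).sub
        (h.hasDerivAt_flux_sq ⟨hs.trans_lt hx.1, hx.2.trans_le hr⟩)) (fun x hx => by
      have hx' : x ∈ Icc 0 R := ⟨hs.trans hx.1.le, hx.2.le.trans hr⟩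
      rw [← sub_mul]
      exact mul_nonneg (sub_nonneg.2 (hhi x (Ioo_subset_Icc_self hx)))
        (mul_nonneg (h.reaction_nonneg hx') (h.D_nonneg hx')))
  linarith

/-- The variable `e^{-pU/2}`, which is almost affine in the boundary layer. -/
noncomputable def decayVar (p : ℝ) (U : ℝ → ℝ) (r : ℝ) : ℝ := Real.exp (-(p / 2) * U r)

theorem decayVar_pos (p : ℝ) (U : ℝ → ℝ) (r : ℝ) : 0 < decayVar p U r := Real.exp_pos _

theorem decayVar_sq_mul_exp (p : ℝ) (U : ℝ → ℝ) (r : ℝ) :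
    decayVar p U r ^ 2 * Real.exp (p * U r) = 1 := by
  unfold decayVar
  rw [← Real.exp_nat_mul, ← Real.exp_add]
  simp
  ring

theorem IncSol.hasDerivAt_decayVar (h : IncSol N R A B p q g ε U) {r : ℝ} (hr : r ∈ Ioo 0 R) :
    HasDerivAt (decayVar p U) (-(p / 2) * (D R U r * decayVar p U r)) r := by
  refine (((h.hasDerivAt hr).const_mul (-(p / 2))).exp).congr_deriv ?_
  unfold decayVar
  ring

theorem IncSol.continuousOn_decayVar (h : IncSol N R A B p q g ε U) :
    ContinuousOn (decayVar p U) (Icc 0 R) :=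
  Real.continuous_exp.comp_continuousOn (continuousOn_const.mul h.continuousOn)

/-- Energy from the origin with a crude constant weight, multiplied by `z² = e^(-pU)`: then `z²
e^(pU) = 1`, and `z² e^(-qU)` is bounded by the uniform lower bound on `U`. -/
theorem Params.exists_flux_mul_decayVar_le (P : Params N R A B p q g) :
    ∃ C > 0, ∀ (ε : ℝ) (U : ℝ → ℝ), IncSol N R A B p q g ε U → ∀ x ∈ Icc 0 R,
      ε * flux N R g U x * decayVar p U x ≤ C := by
  obtain ⟨m, hm, K, hK, hgK⟩ := P.exists_g_bounds
  have hR := P.R_pos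
  have hA := P.A_pos
  have hB := P.B_pos
  have hp := P.p_pos
  have hq := P.q_pos
  set l := lowerBound A B p
  set hi := (R ^ (N - 1)) ^ 2 * K
  have hhi : 0 < hi := by positivity
  set E := A / p + B / q * Real.exp (-(p + q) * l)
  have hE : 0 < E := by positivity
  refine ⟨√(2 * hi * E), Real.sqrt_pos.2 (by positivity), fun ε U h x hx => ?_⟩
  apply Real.le_sqrt_of_sq_le
  have h1 := h.le_mul_potential_sub (hi := hi) le_rfl hx.1 hx.2 (fun y hy => by
    have hy' : y ∈ Icc 0 R := ⟨hy.1, hy.2.trans hx.2⟩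
    exact mul_le_mul (pow_le_pow_left₀ (pow_nonneg hy.1 _) (pow_le_pow_left₀ hy.1 hy'.2 _) _)
      (hgK y hy').2 (P.g_pos y hy').le (by positivity))
  rw [h.flux_zero] at h1
  have hα := h.coef_pos hA p
  have hδ := h.coef_pos hB (-q)
  have h2 : 0 ≤ potential N R A B p q U (U 0) := by unfold potential; positivity
  have hz := decayVar_pos p U x
  have h3 : decayVar p U x ^ 2 * potential N R A B p q U (U x) ≤ E := by
    have a1 : decayVar p U x ^ 2 * Real.exp (-q * U x) ≤ Real.exp (-(p + q) * l) := by
      unfold decayVar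
      rw [← Real.exp_nat_mul, ← Real.exp_add, Real.exp_le_exp]
      have := h.lowerBound_le hx
      push_cast
      nlinarith
    calc _ = coef N R A p U / p * (decayVar p U x ^ 2 * Real.exp (p * U x)) +
          coef N R B (-q) U / q * (decayVar p U x ^ 2 * Real.exp (-q * U x)) := by
          unfold potential; ring
      _ ≤ A / p * 1 + B / q * Real.exp (-(p + q) * l) := by
          rw [decayVar_sq_mul_exp]
          have := h.coef_le hA p
          have := h.coef_le hB (-q)
          gcongr
      _ = E := by rw [mul_one]
  have h4 : ε ^ 2 / 2 * flux N R g U x ^ 2 ≤ hi * potential N R A B p q U (U x) := by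
    nlinarith
  have h5 := mul_le_mul_of_nonneg_left h4 (sq_nonneg (decayVar p U x))
  have h6 := mul_le_mul_of_nonneg_left h3 hhi.le
  nlinarith

/-- The preceding bound gives `z(R) = O(ε)` when the flux at `R` is inserted, and `-z' = (p/2) U' z
= O(1/ε)` on `[R/2, R]`. -/
theorem Params.exists_decayVar_le (P : Params N R A B p q g) :
    ∃ C > 0, ∀ (ε : ℝ) (U : ℝ → ℝ), IncSol N R A B p q g ε U → ∀ x ∈ Icc (R / 2) R,
      decayVar p U x ≤ C * ε + C * ((R - x) / ε) := by
  obtain ⟨m, hm, K, hK, hgK⟩ := P.exists_g_bounds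
  obtain ⟨C, hC, hb⟩ := P.exists_flux_mul_decayVar_le
  have hR := P.R_pos
  have hp := P.p_pos
  set J := R ^ N / N * (A - B) with hJ
  have hJ0 : 0 < J := mul_pos P.vol_pos (sub_pos.2 P.B_lt_A)
  set k := (R / 2) ^ (N - 1) * m with hk
  have hk0 : 0 < k := by positivity
  refine ⟨C / J + p / 2 * (C / k), by positivity, fun ε U h x hx => ?_⟩
  have hε := h.eps_pos
  have hx0 : 0 < x := by linarith [hx.1]
  have h1 : decayVar p U R ≤ C / J * ε := by
    have := hb ε U h R (right_mem_Icc.2 hR.le)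
    rw [h.flux_right, ← hJ] at this
    have e : ε * (J / ε ^ 2) * decayVar p U R = J * decayVar p U R / ε := by field_simp
    rw [e, div_le_iff₀ hε] at this
    rw [div_mul_eq_mul_div, le_div_iff₀ hJ0]
    linarith
  have h2 : decayVar p U x + p / 2 * (C / k / ε) * x ≤
      decayVar p U R + p / 2 * (C / k / ε) * R := by
    refine le_of_hasDerivAt_nonneg (f := fun x => decayVar p U x + p / 2 * (C / k / ε) * x) hx.2
      ((h.continuousOn_decayVar.mono (Icc_subset_Icc hx0.le le_rfl)).add (by fun_prop))
      (fun y hy => (h.hasDerivAt_decayVar ⟨hx0.trans hy.1, hy.2⟩).add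
        ((hasDerivAt_id y).const_mul _)) fun y hy => ?_
    have hy' : y ∈ Icc 0 R := ⟨(hx0.trans hy.1).le, hy.2.le⟩
    have a1 := hb ε U h y hy'
    have hV := h.D_nonneg hy'
    have hz := decayVar_pos p U y
    have a2 : k ≤ y ^ (N - 1) * g y :=
      mul_le_mul (pow_le_pow_left₀ (by linarith) (hx.1.trans hy.1.le) _) (hgK y hy').1 hm.le
        (pow_nonneg hy'.1 _)
    have a3 : D R U y * decayVar p U y ≤ C / k / ε := by
      rw [le_div_iff₀ hε, le_div_iff₀ hk0]
      have := mul_le_mul_of_nonneg_right a2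
        (mul_nonneg (mul_nonneg hV hz.le) hε.le)
      unfold flux at a1
      linarith
    have := mul_le_mul_of_nonneg_left a3 (by positivity : 0 ≤ p / 2)
    linarith
  have e1 : p / 2 * (C / k / ε) * R - p / 2 * (C / k / ε) * x =
      p / 2 * (C / k) * ((R - x) / ε) := by ring
  have h3 : 0 ≤ p / 2 * (C / k) * ε := by positivity
  have h4 : 0 ≤ C / J * ((R - x) / ε) := by
    have := sub_nonneg.2 hx.2
    positivity
  rw [add_mul, add_mul]
  linarith

end Energy

/-! ### Asymptotic slope of `e^(-pU/2)` near the boundary. -/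

section Layer

variable {N : ℕ} {R A B p q : ℝ} {g : ℝ → ℝ} {U : ℝ → ℝ → ℝ}

theorem tendsto_of_tendsto_div {ξ : ℝ → ℝ}
    (hlim : Tendsto (fun ε => (R - ξ ε) / ε) (𝓝[>] 0) (𝓝 0)) :
    Tendsto ξ (𝓝[>] 0) (𝓝 R) := by
  have h1 : Tendsto (fun ε : ℝ => ε) (𝓝[>] 0) (𝓝 0) := nhdsWithin_le_nhds
  have h2 := (hlim.mul h1).const_sub R
  simp only [mul_zero, sub_zero] at h2
  refine h2.congr' ?_
  filter_upwards [eventually_pos_nhdsGT_zero] with ε hε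
  field_simp
  ring

theorem tendsto_decayVar (P : Params N R A B p q g)
    (hU : ∀ ε : ℝ, 0 < ε → IncSol N R A B p q g ε (U ε)) {ξ : ℝ → ℝ}
    (hξ : ∀ᶠ ε : ℝ in 𝓝[>] 0, ξ ε ∈ Icc 0 R)
    (hlim : Tendsto (fun ε => (R - ξ ε) / ε) (𝓝[>] 0) (𝓝 0)) :
    Tendsto (fun ε => decayVar p (U ε) (ξ ε)) (𝓝[>] 0) (𝓝 0) := by
  obtain ⟨C, hC, hb⟩ := P.exists_decayVar_le
  have h1 : Tendsto (fun ε : ℝ => ε) (𝓝[>] 0) (𝓝 0) := nhdsWithin_le_nhds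
  have h2 := (h1.const_mul C).add (hlim.const_mul C)
  simp only [mul_zero, add_zero] at h2
  refine squeeze_zero' (Eventually.of_forall fun ε => (decayVar_pos _ _ _).le) ?_ h2
  filter_upwards [hξ, eventually_pos_nhdsGT_zero,
    (tendsto_of_tendsto_div hlim).eventually_const_le (half_lt_self P.R_pos)] with ε h3 hε h4
  exact hb ε (U ε) (hU ε hε) _ ⟨h4, h3.2⟩

/-- Only the term with `e^(pU(ξ))` survives multiplication by `z² → 0`, since `z² e^(pU(ξ)) = 1`;
its coefficient tends to `B/p`. -/
theorem tendsto_potential_sub (P : Params N R A B p q g)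
    (hU : ∀ ε : ℝ, 0 < ε → IncSol N R A B p q g ε (U ε)) {ξ : ℝ → ℝ}
    (hξ : ∀ᶠ ε : ℝ in 𝓝[>] 0, ξ ε ∈ Icc 0 R)
    (hlim : Tendsto (fun ε => (R - ξ ε) / ε) (𝓝[>] 0) (𝓝 0)) :
    Tendsto (fun ε => decayVar p (U ε) (ξ ε) ^ 2 *
      (potential N R A B p q (U ε) (U ε (ξ ε)) -
        potential N R A B p q (U ε) (U ε (R - ε ^ (1 / 2 : ℝ))))) (𝓝[>] 0) (𝓝 (B / p)) := by
  have hz := (tendsto_decayVar P hU hξ hlim).pow 2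
  rw [zero_pow two_ne_zero] at hz
  have hα := tendsto_coef P hU
  have hδ := tendsto_coef_neg P hU
  have hs := tendsto_U_layer P hU
  have e1 : Tendsto (fun ε => Real.exp (p * U ε (R - ε ^ (1 / 2 : ℝ)))) (𝓝[>] 0) (𝓝 1) := by
    simpa [Function.comp_def] using (Real.continuous_exp.tendsto _).comp (hs.const_mul p)
  have e2 : Tendsto (fun ε => Real.exp (-q * U ε (R - ε ^ (1 / 2 : ℝ)))) (𝓝[>] 0) (𝓝 1) := by
    simpa [Function.comp_def] using (Real.continuous_exp.tendsto _).comp (hs.const_mul (-q))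
  have e3 : Tendsto (fun ε => decayVar p (U ε) (ξ ε) ^ 2 * Real.exp (-q * U ε (ξ ε)))
      (𝓝[>] 0) (𝓝 0) := by
    have h0 := hz.mul_const (Real.exp (-q * lowerBound A B p))
    rw [zero_mul] at h0
    refine squeeze_zero' (Eventually.of_forall fun ε => by positivity) ?_ h0
    filter_upwards [hξ, eventually_pos_nhdsGT_zero] with ε h1 hε
    refine mul_le_mul_of_nonneg_left (Real.exp_le_exp.2 ?_) (sq_nonneg _)
    nlinarith [(hU ε hε).lowerBound_le h1, P.q_pos]
  have hsum := (((hα.div_const p).mul_const 1).add ((hδ.div_const q).mul e3)).sub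
    (hz.mul (((hα.div_const p).mul e1).add ((hδ.div_const q).mul e2)))
  simp only [mul_one, mul_zero, add_zero, zero_mul, sub_zero] at hsum
  refine hsum.congr fun ε => ?_
  unfold potential
  have := decayVar_sq_mul_exp p (U ε) (ξ ε)
  linear_combination (-coef N R A p (U ε) / p) * this

theorem tendsto_flux_mul_decayVar (P : Params N R A B p q g)
    (hU : ∀ ε : ℝ, 0 < ε → IncSol N R A B p q g ε (U ε)) {ξ : ℝ → ℝ}
    (hξ : ∀ᶠ ε : ℝ in 𝓝[>] 0, ξ ε ∈ Icc 0 R)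
    (hlim : Tendsto (fun ε => (R - ξ ε) / ε) (𝓝[>] 0) (𝓝 0)) :
    Tendsto (fun ε => ε * flux N R g (U ε) (ξ ε) * decayVar p (U ε) (ξ ε)) (𝓝[>] 0)
      (𝓝 √(2 * ((R ^ (N - 1)) ^ 2 * g R * (B / p)))) := by
  have hR := P.R_pos
  set G : ℝ → ℝ := fun x => (x ^ (N - 1)) ^ 2 * g x with hG
  set L := B / p with hL
  have hL0 : 0 < L := div_pos P.B_pos P.p_pos
  set s : ℝ → ℝ := fun ε => R - ε ^ (1 / 2 : ℝ) with hs
  set X : ℝ → ℝ := fun ε => decayVar p (U ε) (ξ ε) ^ 2 *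
      (potential N R A B p q (U ε) (U ε (ξ ε)) - potential N R A B p q (U ε) (U ε (s ε))) with hX
  have hXlim : Tendsto X (𝓝[>] 0) (𝓝 L) := tendsto_potential_sub P hU hξ hlim
  set T : ℝ → ℝ := fun ε => decayVar p (U ε) (ξ ε) ^ 2 *
      (ε ^ 2 / 2 * flux N R g (U ε) (ξ ε) ^ 2 - ε ^ 2 / 2 * flux N R g (U ε) (s ε) ^ 2) with hT
  have hsR : Tendsto s (𝓝[>] 0) (𝓝 R) := by
    have := (tendsto_rpow_nhdsGT_zero (by norm_num : (0 : ℝ) < 1 / 2)).const_sub R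
    rwa [sub_zero] at this
  have hGc : ContinuousOn G (Icc 0 R) :=
    (by fun_prop : Continuous fun x : ℝ => (x ^ (N - 1)) ^ 2).continuousOn.mul
      P.g_smooth.continuousOn
  have hosc : ∀ η > 0, ∀ᶠ ε in 𝓝[>] (0 : ℝ), ∀ x ∈ Icc (s ε) R, |G x - G R| ≤ η := by
    intro η hη
    have h1 : ∀ᶠ x in 𝓝[Icc 0 R] R, |G x - G R| < η := by
      have := hGc R (right_mem_Icc.2 hR.le)
      exact Metric.tendsto_nhds.1 this η hη
    obtain ⟨ζ, hζ, hball⟩ := Metric.mem_nhdsWithin_iff.1 h1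
    filter_upwards [hsR.eventually_const_le (half_lt_self hR),
      hsR.eventually_const_lt (by linarith : R - ζ < R)] with ε h2 h3 x hx
    refine le_of_lt (hball ⟨?_, by linarith [hx.1], hx.2⟩)
    rw [Metric.mem_ball, Real.dist_eq, abs_sub_comm, abs_of_nonneg (sub_nonneg.2 hx.2)]
    linarith [hx.1]
  have hord : ∀ᶠ ε : ℝ in 𝓝[>] 0, 0 < ε ∧ 0 ≤ s ε ∧ s ε ≤ ξ ε ∧ ξ ε ≤ R := by
    filter_upwards [hξ, hlim.eventually_lt_const one_pos, eventually_pos_nhdsGT_zero,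
      eventually_lt_nhdsGT_zero one_pos, hsR.eventually_const_le hR] with ε h1 h2 hε h3 h4
    refine ⟨hε, h4, ?_, h1.2⟩
    rw [div_lt_one hε] at h2
    have : ε ≤ ε ^ (1 / 2 : ℝ) := by
      have := Real.rpow_le_rpow_of_exponent_ge hε h3.le (by norm_num : (1 / 2 : ℝ) ≤ 1)
      rwa [Real.rpow_one] at this
    simp only [hs]
    linarith
  have hTlim : Tendsto T (𝓝[>] 0) (𝓝 (G R * L)) := by
    refine tendsto_order.2 ⟨fun a ha => ?_, fun a ha => ?_⟩
    -- This `η` places `(G R - η) L` halfway between `a` and `G R * L`. No sign of `G R - η` is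
    -- needed.
    · set η := (G R * L - a) / (2 * L) with hη
      have hη0 : 0 < η := div_pos (by linarith) (by linarith)
      have h1 : a < (G R - η) * L := by
        have : η * L = (G R * L - a) / 2 := by rw [hη]; field_simp
        rw [sub_mul, this]; linarith
      filter_upwards [hord, hosc η hη0, (hXlim.const_mul (G R - η)).eventually_const_lt h1]
        with ε ho h2 h3
      refine h3.trans_le ?_
      have h4 := (hU ε ho.1).mul_potential_sub_le (lo := G R - η) ho.2.1 ho.2.2.1 ho.2.2.2
        (fun x hx => by
          have := (abs_le.1 (h2 x ⟨hx.1, hx.2.trans ho.2.2.2⟩)).1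
          change G R - η ≤ G x
          linarith)
      have := mul_le_mul_of_nonneg_left h4 (sq_nonneg (decayVar p (U ε) (ξ ε)))
      simp only [hX, hT]
      linarith
    · set η := (a - G R * L) / (2 * L) with hη
      have hη0 : 0 < η := div_pos (by linarith) (by linarith)
      have h1 : (G R + η) * L < a := by
        have : η * L = (a - G R * L) / 2 := by rw [hη]; field_simp
        rw [add_mul, this]; linarith
      filter_upwards [hord, hosc η hη0, (hXlim.const_mul (G R + η)).eventually_lt_const h1]
        with ε ho h2 h3
      refine lt_of_le_of_lt ?_ h3
      have h4 := (hU ε ho.1).le_mul_potential_sub (hi := G R + η) ho.2.1 ho.2.2.1 ho.2.2.2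
        (fun x hx => by
          have := (abs_le.1 (h2 x ⟨hx.1, hx.2.trans ho.2.2.2⟩)).2
          change G x ≤ G R + η
          linarith)
      have := mul_le_mul_of_nonneg_left h4 (sq_nonneg (decayVar p (U ε) (ξ ε)))
      simp only [hX, hT]
      linarith
  have hε0 : Tendsto (fun ε : ℝ => ε) (𝓝[>] 0) (𝓝 0) := nhdsWithin_le_nhds
  -- The energy at the reference point `R - √ε` is negligible, so the difference of energies
  -- determines `ε w z`.
  have hrem := (((hε0.mul (tendsto_flux_layer P hU)).mul
    (tendsto_decayVar P hU hξ hlim)).pow 2)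
  have hsq := (hTlim.const_mul 2).add hrem
  simp only [mul_zero, ne_eq, OfNat.ofNat_ne_zero, not_false_eq_true, zero_pow, add_zero] at hsq
  have hroot := hsq.sqrt
  refine hroot.congr' ?_
  filter_upwards [hord] with ε ho
  have h1 : 0 ≤ ε * flux N R g (U ε) (ξ ε) * decayVar p (U ε) (ξ ε) :=
    mul_nonneg (mul_nonneg ho.1.le ((hU ε ho.1).flux_nonneg ⟨ho.2.1.trans ho.2.2.1, ho.2.2.2⟩))
      (decayVar_pos _ _ _).le
  rw [← Real.sqrt_sq h1]
  congr 1
  simp only [hT, hs]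
  ring

/-- At distance `o(ε)` from the boundary, `ε` times the derivative of `U` times `e^{-pU/2}` tends
to `√(2B/(p g(R)))`. -/
theorem tendsto_D_mul_decayVar (P : Params N R A B p q g)
    (hU : ∀ ε : ℝ, 0 < ε → IncSol N R A B p q g ε (U ε)) {ξ : ℝ → ℝ}
    (hξ : ∀ᶠ ε : ℝ in 𝓝[>] 0, ξ ε ∈ Icc 0 R)
    (hlim : Tendsto (fun ε => (R - ξ ε) / ε) (𝓝[>] 0) (𝓝 0)) :
    Tendsto (fun ε => ε * D R (U ε) (ξ ε) * decayVar p (U ε) (ξ ε)) (𝓝[>] 0)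
      (𝓝 (2 * √(B / (2 * p * g R)))) := by
  have hR := P.R_pos
  have hRm : R ∈ Icc 0 R := right_mem_Icc.2 hR.le
  have hgR := P.g_pos R hRm
  have hp := P.p_pos
  have hB := P.B_pos
  have h1 := tendsto_flux_mul_decayVar P hU hξ hlim
  have hξR := tendsto_of_tendsto_div hlim
  have hg : Tendsto (fun ε => g (ξ ε)) (𝓝[>] 0) (𝓝 (g R)) :=
    (P.g_smooth.continuousOn R hRm).tendsto.comp (tendsto_nhdsWithin_iff.2 ⟨hξR, hξ⟩)
  have h2 := h1.div ((hξR.pow (N - 1)).mul hg) (by positivity)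
  have e : √(2 * ((R ^ (N - 1)) ^ 2 * g R * (B / p))) / (R ^ (N - 1) * g R) =
      2 * √(B / (2 * p * g R)) := by
    have e1 : 2 * ((R ^ (N - 1)) ^ 2 * g R * (B / p)) =
        (2 * (R ^ (N - 1) * g R)) ^ 2 * (B / (2 * p * g R)) := by
      field_simp
    rw [e1, Real.sqrt_mul (sq_nonneg _), Real.sqrt_sq (by positivity)]
    field_simp
  rw [e] at h2
  refine h2.congr' ?_
  filter_upwards [hξ, hξR.eventually_const_lt hR] with ε h3 h4
  have := P.g_pos _ h3
  simp only [Pi.div_apply]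
  unfold flux
  field_simp

end Layer

/-! ### Expansions of `U`, `U'` and the charge density at distance `ε^β`. -/

theorem isEquivalent_const_mul_rpow {f : ℝ → ℝ} {c e : ℝ} (hc : c ≠ 0)
    (h : Tendsto (fun ε => f ε / ε ^ e) (𝓝[>] 0) (𝓝 c)) :
    f ~[𝓝[>] 0] fun ε => c * ε ^ e := by
  refine isEquivalent_of_tendsto_one ?_
  have h1 := h.div_const c
  rw [div_self hc] at h1
  refine h1.congr' ?_
  filter_upwards [eventually_pos_nhdsGT_zero] with ε hε
  have := (Real.rpow_pos_of_pos hε e).ne'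
  simp only [Pi.div_apply]
  field_simp

/-- The indicators arise as limits of powers: after division by `ε^(min 1 (β-1))`, the terms of
order `ε^(β-1)` and `ε` keep exactly the weights `chi1 β` and `chi2 β`. -/
theorem tendsto_rpow_chi1 (β : ℝ) :
    Tendsto (fun ε : ℝ => ε ^ (β - 1 - min 1 (β - 1))) (𝓝[>] 0) (𝓝 (chi1 β)) := by
  unfold chi1
  split_ifs with h
  · rw [min_eq_right (by linarith)]
    simp
  · rw [not_le] at h
    rw [min_eq_left (by linarith)]
    exact tendsto_rpow_nhdsGT_zero (by linarith)

theorem tendsto_rpow_chi2 (β : ℝ) :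
    Tendsto (fun ε : ℝ => ε ^ (1 - min 1 (β - 1))) (𝓝[>] 0) (𝓝 (chi2 β)) := by
  unfold chi2
  split_ifs with h
  · rw [min_eq_left (by linarith)]
    simp
  · rw [not_le] at h
    rw [min_eq_right (by linarith)]
    exact tendsto_rpow_nhdsGT_zero (by linarith)

/-- The constant `γ p χ₁(β) + (2 N g(R) / (R (A - B))) χ₂(β)` of the boundary expansion. -/
noncomputable def layerConst (N : ℕ) (R A B p gR β γ : ℝ) : ℝ :=
  γ * p * chi1 β + 2 * N * gR / (R * (A - B)) * chi2 β

section Layer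

variable {N : ℕ} {R A B p q : ℝ} {g : ℝ → ℝ} {U : ℝ → ℝ → ℝ} {β γ : ℝ} {r : ℝ → ℝ}

theorem Params.g_right_pos (P : Params N R A B p q g) : 0 < g R :=
  P.g_pos R (right_mem_Icc.2 P.R_pos.le)

theorem Params.layerConst_pos (P : Params N R A B p q g) (hγ : 0 < γ) :
    0 < layerConst N R A B p (g R) β γ := by
  have hR := P.R_pos
  have hN := P.N_pos
  have hp := P.p_pos
  have hg := P.g_right_pos
  have hAB := sub_pos.2 P.B_lt_A
  unfold layerConst chi1 chi2
  split_ifs with h1 h2 h2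
  · positivity
  · simp only [mul_one, mul_zero, add_zero]; positivity
  · simp only [mul_one, mul_zero, zero_add]; positivity
  · exact absurd (le_of_not_ge h1) h2

theorem tendsto_div_of_tendsto_div_rpow (hβ : 1 < β)
    (hlim : Tendsto (fun ε : ℝ => (R - r ε) / ε ^ β) (𝓝[>] 0) (𝓝 γ)) :
    Tendsto (fun ε => (R - r ε) / ε) (𝓝[>] 0) (𝓝 0) := by
  have h := hlim.mul (tendsto_rpow_nhdsGT_zero (sub_pos.2 hβ))
  rw [mul_zero] at h
  refine h.congr' ?_
  filter_upwards [eventually_pos_nhdsGT_zero] with ε hε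
  have := (Real.rpow_pos_of_pos hε β).ne'
  rw [Real.rpow_sub hε, Real.rpow_one]
  field_simp

/-- At `R` the derivative is known exactly, so the limit of `ε U'(R) z(R)` can be solved for
`z(R)/ε`. -/
theorem tendsto_decayVar_right (P : Params N R A B p q g)
    (hU : ∀ ε : ℝ, 0 < ε → IncSol N R A B p q g ε (U ε)) :
    Tendsto (fun ε => decayVar p (U ε) R / ε) (𝓝[>] 0)
      (𝓝 (√(B / (2 * p * g R)) * (2 * N * g R / (R * (A - B))))) := by
  have hR := P.R_pos
  have hN := P.N_pos
  have hg := P.g_right_pos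
  have hAB := sub_pos.2 P.B_lt_A
  have h1 := (tendsto_D_mul_decayVar P hU (ξ := fun _ => R)
    (Eventually.of_forall fun _ => right_mem_Icc.2 hR.le) (by simp)).mul_const
      (N * g R / (R * (A - B)))
  have e : 2 * √(B / (2 * p * g R)) * (N * g R / (R * (A - B))) =
      √(B / (2 * p * g R)) * (2 * N * g R / (R * (A - B))) := by ring
  rw [e] at h1
  refine h1.congr' ?_
  filter_upwards [eventually_pos_nhdsGT_zero] with ε hε
  rw [(hU ε hε).sol.deriv_right]
  field_simp

/-- The mean value theorem writes `z(r)` as `z(R)` plus slope times `R - r`. The intermediate point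
is also within `o(ε)` of `R`, so the slope limit applies to it. -/
theorem tendsto_decayVar_div (P : Params N R A B p q g)
    (hU : ∀ ε : ℝ, 0 < ε → IncSol N R A B p q g ε (U ε)) (hβ : 1 < β)
    (hr : ∀ᶠ ε : ℝ in 𝓝[>] 0, r ε ∈ Ioo 0 R)
    (hlim : Tendsto (fun ε : ℝ => (R - r ε) / ε ^ β) (𝓝[>] 0) (𝓝 γ)) :
    Tendsto (fun ε => decayVar p (U ε) (r ε) / ε ^ (min 1 (β - 1))) (𝓝[>] 0)
      (𝓝 (√(B / (2 * p * g R)) * layerConst N R A B p (g R) β γ)) := by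
  have hlim' := tendsto_div_of_tendsto_div_rpow hβ hlim
  have hmv : ∀ᶠ ε : ℝ in 𝓝[>] 0, ∃ c, c ∈ Ioo (r ε) R ∧
      decayVar p (U ε) (r ε) = decayVar p (U ε) R +
        p / 2 * (D R (U ε) c * decayVar p (U ε) c) * (R - r ε) := by
    filter_upwards [hr, eventually_pos_nhdsGT_zero] with ε h1 hε
    have h := hU ε hε
    obtain ⟨c, hc, hc'⟩ := exists_hasDerivAt_eq_slope (decayVar p (U ε)) _ h1.2
      (h.continuousOn_decayVar.mono (Icc_subset_Icc h1.1.le le_rfl))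
      (fun x hx => h.hasDerivAt_decayVar ⟨h1.1.trans hx.1, hx.2⟩)
    refine ⟨c, hc, ?_⟩
    rw [eq_div_iff (sub_pos.2 h1.2).ne'] at hc'
    linarith
  obtain ⟨ξ, hξ⟩ := hmv.choice
  have hξm : ∀ᶠ ε : ℝ in 𝓝[>] 0, ξ ε ∈ Icc 0 R := by
    filter_upwards [hr, hξ] with ε h1 h2
    exact ⟨(h1.1.trans h2.1.1).le, h2.1.2.le⟩
  have hξlim : Tendsto (fun ε => (R - ξ ε) / ε) (𝓝[>] 0) (𝓝 0) := by
    refine squeeze_zero' ?_ ?_ hlim'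
    · filter_upwards [hξm, eventually_pos_nhdsGT_zero] with ε h1 hε
      exact div_nonneg (sub_nonneg.2 h1.2) hε.le
    · filter_upwards [hξ, eventually_pos_nhdsGT_zero] with ε h1 hε
      have := h1.1.1.le
      gcongr
  have h1 := ((tendsto_decayVar_right P hU).mul (tendsto_rpow_chi2 β)).add
    ((((tendsto_D_mul_decayVar P hU hξm hξlim).const_mul (p / 2)).mul hlim).mul
      (tendsto_rpow_chi1 β))
  have e : √(B / (2 * p * g R)) * layerConst N R A B p (g R) β γ =
      √(B / (2 * p * g R)) * (2 * N * g R / (R * (A - B))) * chi2 β +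
        p / 2 * (2 * √(B / (2 * p * g R))) * γ * chi1 β := by
    unfold layerConst; ring
  rw [e]
  refine h1.congr' ?_
  filter_upwards [hξ, eventually_pos_nhdsGT_zero] with ε h2 hε
  rw [h2.2, Real.rpow_sub hε, Real.rpow_sub hε, Real.rpow_sub hε, Real.rpow_one]
  have a1 := (Real.rpow_pos_of_pos hε β).ne'
  have a2 := (Real.rpow_pos_of_pos hε (min 1 (β - 1))).ne'
  field_simp

theorem isLittleO_of_tendsto_decayVar {m L : ℝ} (hp : 0 < p) (hL : 0 < L)
    (h : Tendsto (fun ε => decayVar p (U ε) (r ε) / ε ^ m) (𝓝[>] 0) (𝓝 L)) :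
    (fun ε => U ε (r ε) - (2 / p * m * Real.log (1 / ε) - 2 / p * Real.log L))
      =o[𝓝[>] 0] (fun _ => (1 : ℝ)) := by
  rw [isLittleO_one_iff]
  have h1 := ((h.log hL.ne').sub_const (Real.log L)).const_mul (-(2 / p))
  rw [sub_self, mul_zero] at h1
  refine h1.congr' ?_
  filter_upwards [eventually_pos_nhdsGT_zero] with ε hε
  rw [Real.log_div (decayVar_pos _ _ _).ne' (Real.rpow_pos_of_pos hε m).ne',
    Real.log_rpow hε, one_div, Real.log_inv]
  unfold decayVar
  rw [Real.log_exp]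
  field_simp
  ring

theorem tendsto_U_atTop (P : Params N R A B p q g)
    (hU : ∀ ε : ℝ, 0 < ε → IncSol N R A B p q g ε (U ε)) (hβ : 1 < β)
    (hr : ∀ᶠ ε : ℝ in 𝓝[>] 0, r ε ∈ Ioo 0 R)
    (hlim : Tendsto (fun ε : ℝ => (R - r ε) / ε ^ β) (𝓝[>] 0) (𝓝 γ)) :
    Tendsto (fun ε => U ε (r ε)) (𝓝[>] 0) atTop := by
  have h1 := tendsto_decayVar P hU (hr.mono fun _ h => Ioo_subset_Icc_self h)
    (tendsto_div_of_tendsto_div_rpow hβ hlim)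
  have h2 := Real.tendsto_log_nhdsGT_zero.comp (tendsto_nhdsWithin_iff.2
    ⟨h1, Eventually.of_forall fun ε => decayVar_pos p (U ε) (r ε)⟩)
  have h3 := h2.const_mul_atBot_of_neg (neg_lt_zero.2 (div_pos two_pos P.p_pos))
  refine h3.congr fun ε => ?_
  have := P.p_pos.ne'
  simp only [Function.comp_apply, decayVar, Real.log_exp]
  field_simp

theorem isEquivalent_D (P : Params N R A B p q g)
    (hU : ∀ ε : ℝ, 0 < ε → IncSol N R A B p q g ε (U ε)) (hβ : 1 < β) (hγ : 0 < γ)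
    (hr : ∀ᶠ ε : ℝ in 𝓝[>] 0, r ε ∈ Ioo 0 R)
    (hlim : Tendsto (fun ε : ℝ => (R - r ε) / ε ^ β) (𝓝[>] 0) (𝓝 γ)) :
    (fun ε => D R (U ε) (r ε)) ~[𝓝[>] 0] fun ε =>
      2 / layerConst N R A B p (g R) β γ * ε ^ (-(1 + min 1 (β - 1))) := by
  have hQ := P.layerConst_pos (β := β) hγ
  have hp := P.p_pos
  have hg := P.g_right_pos
  have hB := P.B_pos
  have hS : 0 < √(B / (2 * p * g R)) := Real.sqrt_pos.2 (by positivity)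
  refine isEquivalent_const_mul_rpow (by positivity) ?_
  have h1 := (tendsto_D_mul_decayVar P hU (hr.mono fun _ h => Ioo_subset_Icc_self h)
    (tendsto_div_of_tendsto_div_rpow hβ hlim)).div (tendsto_decayVar_div P hU hβ hr hlim)
    (by positivity)
  have e : 2 * √(B / (2 * p * g R)) / (√(B / (2 * p * g R)) * layerConst N R A B p (g R) β γ) =
      2 / layerConst N R A B p (g R) β γ := by field_simp
  rw [e] at h1
  refine h1.congr' ?_
  filter_upwards [eventually_pos_nhdsGT_zero] with ε hε
  have a1 := (decayVar_pos p (U ε) (r ε)).ne'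
  have a2 := (Real.rpow_pos_of_pos hε (min 1 (β - 1))).ne'
  simp only [Pi.div_apply]
  rw [Real.rpow_neg hε.le, Real.rpow_add hε, Real.rpow_one]
  field_simp

/-- As `U → ∞` the `e^(-qU)` term disappears and the density behaves like `-B / z²`. -/
theorem isEquivalent_chargeDensity (P : Params N R A B p q g)
    (hU : ∀ ε : ℝ, 0 < ε → IncSol N R A B p q g ε (U ε)) (hβ : 1 < β) (hγ : 0 < γ)
    (hr : ∀ᶠ ε : ℝ in 𝓝[>] 0, r ε ∈ Ioo 0 R)
    (hlim : Tendsto (fun ε : ℝ => (R - r ε) / ε ^ β) (𝓝[>] 0) (𝓝 γ)) :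
    (fun ε => chargeDensity N R A B p q (U ε) (r ε)) ~[𝓝[>] 0] fun ε =>
      -(2 * p * g R / layerConst N R A B p (g R) β γ ^ 2) * ε ^ (-2 * min 1 (β - 1)) := by
  have hQ := P.layerConst_pos (β := β) hγ
  have hp := P.p_pos
  have hg := P.g_right_pos
  have hB := P.B_pos
  have hS : 0 < √(B / (2 * p * g R)) := Real.sqrt_pos.2 (by positivity)
  have hm : 0 < min 1 (β - 1) := lt_min one_pos (by linarith)
  refine isEquivalent_const_mul_rpow (neg_ne_zero.2 (by positivity)) ?_
  have h0 : Tendsto (fun ε => Real.exp (-q * U ε (r ε))) (𝓝[>] 0) (𝓝 0) :=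
    Real.tendsto_exp_atBot.comp
      ((tendsto_U_atTop P hU hβ hr hlim).const_mul_atTop_of_neg (neg_lt_zero.2 P.q_pos))
  have h1 := (((tendsto_coef P hU).div ((tendsto_decayVar_div P hU hβ hr hlim).pow 2)
    (by positivity)).sub (((tendsto_coef_neg P hU).mul h0).mul
      ((tendsto_rpow_nhdsGT_zero hm).pow 2))).neg
  have e : -(B / (√(B / (2 * p * g R)) * layerConst N R A B p (g R) β γ) ^ 2 -
      B * 0 * 0 ^ 2) = -(2 * p * g R / layerConst N R A B p (g R) β γ ^ 2) := by
    rw [mul_pow, Real.sq_sqrt (by positivity)]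
    field_simp
    ring
  rw [e] at h1
  refine h1.congr' ?_
  filter_upwards [eventually_pos_nhdsGT_zero] with ε hε
  rw [chargeDensity_eq_neg_reaction]
  have a1 := (decayVar_pos p (U ε) (r ε)).ne'
  have a2 := (Real.rpow_pos_of_pos hε (min 1 (β - 1))).ne'
  have a3 : Real.exp (p * U ε (r ε)) = 1 / decayVar p (U ε) (r ε) ^ 2 := by
    rw [eq_div_iff (pow_ne_zero 2 a1), mul_comm]
    exact decayVar_sq_mul_exp _ _ _
  have a4 : ε ^ (-2 * min 1 (β - 1)) = ((ε ^ min 1 (β - 1)) ^ 2)⁻¹ := by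
    rw [← Real.rpow_natCast, ← Real.rpow_mul hε.le, ← Real.rpow_neg hε.le]
    congr 1
    push_cast
    ring
  unfold reaction
  simp only [Pi.div_apply]
  rw [a3, a4]
  field_simp

end Layer

/-! ### Reflection `U ↦ -U`, exchanging `(A, p)` and `(B, q)`. -/

theorem D_neg (R : ℝ) (U : ℝ → ℝ) (r : ℝ) : D R (fun x => -U x) r = -D R U r :=
  derivWithin.fun_neg

theorem IsNeumannSolution.neg {N : ℕ} {R A B p q ε : ℝ} {g U : ℝ → ℝ}
    (h : IsNeumannSolution N R A B p q g ε U) :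
    IsNeumannSolution N R B A q p g ε (fun x => -U x) := by
  have hD : ∀ f : ℝ → ℝ, D R (fun x => -f x) = fun x => -D R f x := fun f => funext (D_neg R f)
  refine ⟨h.contDiffOn_Icc.neg, h.contDiffOn_Ioo.neg, fun r hr => ?_, ?_, ?_, ?_⟩
  · have h1 := h.equation r hr
    rw [hD, hD]
    simp only [mul_neg, neg_mul, neg_neg] at h1 ⊢
    linear_combination -h1
  · simp only [mul_neg, intervalIntegral.integral_neg, h.mean_zero, neg_zero]
  · rw [hD]
    simp only [h.deriv_zero, neg_zero]
  · rw [hD]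
    simp only [h.deriv_right]
    ring

theorem chargeDensity_neg (N : ℕ) (R A B p q : ℝ) (U : ℝ → ℝ) (r : ℝ) :
    chargeDensity N R B A q p (fun x => -U x) r = -chargeDensity N R A B p q U r := by
  unfold chargeDensity
  simp only [mul_neg, neg_mul, neg_neg]
  ring

theorem isEquivalent_of_neg {l : Filter ℝ} {f v w : ℝ → ℝ} (h : (fun ε => -f ε) ~[l] v)
    (hw : ∀ ε, w ε = -v ε) : f ~[l] w := by
  have h1 : (fun ε => -(-f ε)) ~[l] fun ε => -v ε := h.neg
  rw [funext hw]
  simpa only [neg_neg] using h1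

/-! ### The three regimes of `β`, and assembly of the theorem. -/

section Expansion

variable {N : ℕ} {R A B p q : ℝ} {g : ℝ → ℝ} {U : ℝ → ℝ → ℝ} {β γ : ℝ} {r : ℝ → ℝ}

theorem boundary_layer_expansion (P : Params N R A B p q g)
    (hU : ∀ ε : ℝ, 0 < ε → IncSol N R A B p q g ε (U ε)) (hβ : 1 < β) (hγ : 0 < γ)
    (hr : ∀ᶠ ε : ℝ in 𝓝[>] 0, r ε ∈ Ioo 0 R)
    (hlim : Tendsto (fun ε : ℝ => (R - r ε) / ε ^ β) (𝓝[>] 0) (𝓝 γ)) :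
    Tendsto (fun ε => U ε (r ε)) (𝓝[>] 0) atTop ∧
    (fun ε => U ε (r ε) -
        (2 / p * min 1 (β - 1) * Real.log (1 / ε) -
          2 / p * Real.log (√(B / (2 * p * g R)) *
            (γ * p * chi1 β + 2 * N * g R / (R * (A - B)) * chi2 β))))
      =o[𝓝[>] 0] (fun _ => (1 : ℝ)) ∧
    (β < 2 →
      (fun ε => D R (U ε) (r ε)) ~[𝓝[>] 0] (fun ε => 2 / (γ * p) * ε ^ (-β)) ∧
      (fun ε => chargeDensity N R A B p q (U ε) (r ε))
        ~[𝓝[>] 0] (fun ε => -(2 * g R / (γ ^ 2 * p)) * ε ^ (-2 * (β - 1)))) ∧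
    (β = 2 →
      (fun ε => D R (U ε) (r ε))
        ~[𝓝[>] 0] (fun ε => 2 / (γ * p + 2 * N * g R / (R * (A - B))) * ε ^ (-2 : ℝ)) ∧
      (fun ε => chargeDensity N R A B p q (U ε) (r ε))
        ~[𝓝[>] 0] (fun ε =>
          -(2 * p * g R / (γ * p + 2 * N * g R / (R * (A - B))) ^ 2) * ε ^ (-2 : ℝ))) ∧
    (2 < β →
      (fun ε => D R (U ε) (r ε))
        ~[𝓝[>] 0] (fun ε => R * (A - B) / (N * g R) * ε ^ (-2 : ℝ)) ∧
      (fun ε => chargeDensity N R A B p q (U ε) (r ε))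
        ~[𝓝[>] 0] (fun ε =>
          -(p * R ^ 2 * (A - B) ^ 2 / (2 * N ^ 2 * g R)) * ε ^ (-2 : ℝ)) ∧
      (fun ε => U ε R -
          (2 / p * min 1 (β - 1) * Real.log (1 / ε) -
            2 / p * Real.log (√(B / (2 * p * g R)) *
              (γ * p * chi1 β + 2 * N * g R / (R * (A - B)) * chi2 β))))
        =o[𝓝[>] 0] (fun _ => (1 : ℝ)) ∧
      (fun ε => D R (U ε) R)
        ~[𝓝[>] 0] (fun ε => R * (A - B) / (N * g R) * ε ^ (-2 : ℝ))) := by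
  have hR := P.R_pos
  have hN := P.N_pos
  have hQ := P.layerConst_pos (β := β) hγ
  have hp := P.p_pos
  have hg := P.g_right_pos
  have hB := P.B_pos
  have hAB := sub_pos.2 P.B_lt_A
  have hS : 0 < √(B / (2 * p * g R)) := Real.sqrt_pos.2 (by positivity)
  have hD := isEquivalent_D P hU hβ hγ hr hlim
  have hρ := isEquivalent_chargeDensity P hU hβ hγ hr hlim
  refine ⟨tendsto_U_atTop P hU hβ hr hlim,
    isLittleO_of_tendsto_decayVar hp (mul_pos hS hQ) (tendsto_decayVar_div P hU hβ hr hlim),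
    fun h => ?_, fun h => ?_, fun h => ?_⟩
  · have e1 : min 1 (β - 1) = β - 1 := min_eq_right (by linarith)
    have e2 : layerConst N R A B p (g R) β γ = γ * p := by
      simp [layerConst, chi1, chi2, h.le, h.not_ge]
    rw [e1, e2] at hD hρ
    constructor
    · convert hD using 4
      ring
    · convert hρ using 4
      field_simp
  · have e1 : min 1 (β - 1) = 1 := min_eq_left (by linarith)
    have e2 : layerConst N R A B p (g R) β γ = γ * p + 2 * N * g R / (R * (A - B)) := by
      simp [layerConst, chi1, chi2, h]
    rw [e1, e2] at hD hρ
    constructor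
    · convert hD using 4
      norm_num
    · convert hρ using 4
      norm_num
  · have e1 : min 1 (β - 1) = 1 := min_eq_left (by linarith)
    have e2 : layerConst N R A B p (g R) β γ = 2 * N * g R / (R * (A - B)) := by
      simp [layerConst, chi1, chi2, h.le, h.not_ge]
    have e3 : γ * p * chi1 β + 2 * N * g R / (R * (A - B)) * chi2 β =
        2 * N * g R / (R * (A - B)) := e2
    rw [e1, e2] at hD hρ
    refine ⟨?_, ?_, ?_, ?_⟩
    · have e4 : 2 / (2 * N * g R / (R * (A - B))) = R * (A - B) / (N * g R) := by field_simp
      rw [e4] at hD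
      convert hD using 4
      norm_num
    · have e4 : 2 * p * g R / (2 * N * g R / (R * (A - B))) ^ 2 =
          p * R ^ 2 * (A - B) ^ 2 / (2 * N ^ 2 * g R) := by
        field_simp
      rw [e4] at hρ
      convert hρ using 4
      norm_num
    · rw [e1, e3]
      refine isLittleO_of_tendsto_decayVar (r := fun _ => R) hp (mul_pos hS (by positivity)) ?_
      simpa only [Real.rpow_one] using tendsto_decayVar_right P hU
    -- At `R` the claim is an exact equality: the Neumann condition itself.
    · refine IsEquivalent.refl.congr_left ?_
      filter_upwards [eventually_pos_nhdsGT_zero] with ε hε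
      rw [(hU ε hε).sol.deriv_right, Real.rpow_neg hε.le, Real.rpow_two]
      field_simp

end Expansion

end RadialPB

theorem theorem5p1
    (N : ℕ) (hN : 2 ≤ N) (R A B p q : ℝ) (hR : 0 < R) (hA : 0 < A) (hB : 0 < B)
    (hp : 0 < p) (hq : 0 < q) (hAB : A ≠ B)
    (g : ℝ → ℝ) (hg : ContDiffOn ℝ ∞ g (Icc 0 R)) (hgpos : ∀ r ∈ Icc 0 R, 0 < g r)
    (U : ℝ → ℝ → ℝ)
    (hU : ∀ ε : ℝ, 0 < ε → RadialPB.IsNeumannSolution N R A B p q g ε (U ε)) :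
    -- monotonicity
    (A < B → ∀ ε : ℝ, 0 < ε → AntitoneOn (U ε) (Icc 0 R)) ∧
    (B < A → ∀ ε : ℝ, 0 < ε → MonotoneOn (U ε) (Icc 0 R)) ∧
    -- (I) interior estimates
    (∀ κ ∈ Ioo (0 : ℝ) 1, ∃ C > (0 : ℝ), ∃ M > (0 : ℝ), ∀ᶠ ε : ℝ in 𝓝[>] 0,
      ∀ r ∈ Icc 0 (R - ε ^ κ),
        |U ε r| ≤ C * ε ^ κ * Real.log (1 / ε) ∧
        r ^ (N - 1) * |RadialPB.D R (U ε) r| ≤ Real.exp (-(M / ε ^ (1 - κ)))) ∧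
    -- (II) boundary layer
    (∀ β : ℝ, 1 < β → ∀ γ : ℝ, 0 < γ → ∀ r : ℝ → ℝ,
      (∀ᶠ ε : ℝ in 𝓝[>] 0, r ε ∈ Ioo 0 R) →
      Tendsto (fun ε : ℝ => (R - r ε) / ε ^ β) (𝓝[>] 0) (𝓝 γ) →
      -- the case `0 < A < B`
      (A < B →
        Tendsto (fun ε => U ε (r ε)) (𝓝[>] 0) atBot ∧
        (fun ε => U ε (r ε) -
            (-(2 / q) * min 1 (β - 1) * Real.log (1 / ε) +
              2 / q * Real.log (√(A / (2 * q * g R)) *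
                (γ * q * RadialPB.chi1 β + 2 * N * g R / (R * (B - A)) * RadialPB.chi2 β))))
          =o[𝓝[>] 0] (fun _ => (1 : ℝ)) ∧
        (β < 2 →
          (fun ε => RadialPB.D R (U ε) (r ε))
            ~[𝓝[>] 0] (fun ε => -(2 / (γ * q)) * ε ^ (-β)) ∧
          (fun ε => RadialPB.chargeDensity N R A B p q (U ε) (r ε))
            ~[𝓝[>] 0] (fun ε => 2 * g R / (γ ^ 2 * q) * ε ^ (-2 * (β - 1)))) ∧
        (β = 2 →
          (fun ε => RadialPB.D R (U ε) (r ε))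
            ~[𝓝[>] 0] (fun ε => -(2 / (γ * q + 2 * N * g R / (R * (B - A)))) * ε ^ (-2 : ℝ)) ∧
          (fun ε => RadialPB.chargeDensity N R A B p q (U ε) (r ε))
            ~[𝓝[>] 0] (fun ε =>
              2 * q * g R / (γ * q + 2 * N * g R / (R * (B - A))) ^ 2 * ε ^ (-2 : ℝ))) ∧
        (2 < β →
          (fun ε => RadialPB.D R (U ε) (r ε))
            ~[𝓝[>] 0] (fun ε => -(R * (B - A) / (N * g R)) * ε ^ (-2 : ℝ)) ∧
          (fun ε => RadialPB.chargeDensity N R A B p q (U ε) (r ε))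
            ~[𝓝[>] 0] (fun ε =>
              q * R ^ 2 * (B - A) ^ 2 / (2 * N ^ 2 * g R) * ε ^ (-2 : ℝ)) ∧
          -- `U_ε(R)` and `U_ε'(R)` have the same expansions
          (fun ε => U ε R -
              (-(2 / q) * min 1 (β - 1) * Real.log (1 / ε) +
                2 / q * Real.log (√(A / (2 * q * g R)) *
                  (γ * q * RadialPB.chi1 β + 2 * N * g R / (R * (B - A)) * RadialPB.chi2 β))))
            =o[𝓝[>] 0] (fun _ => (1 : ℝ)) ∧
          (fun ε => RadialPB.D R (U ε) R)
            ~[𝓝[>] 0] (fun ε => -(R * (B - A) / (N * g R)) * ε ^ (-2 : ℝ)))) ∧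
      -- the case `0 < B < A`
      (B < A →
        Tendsto (fun ε => U ε (r ε)) (𝓝[>] 0) atTop ∧
        (fun ε => U ε (r ε) -
            (2 / p * min 1 (β - 1) * Real.log (1 / ε) -
              2 / p * Real.log (√(B / (2 * p * g R)) *
                (γ * p * RadialPB.chi1 β + 2 * N * g R / (R * (A - B)) * RadialPB.chi2 β))))
          =o[𝓝[>] 0] (fun _ => (1 : ℝ)) ∧
        (β < 2 →
          (fun ε => RadialPB.D R (U ε) (r ε))
            ~[𝓝[>] 0] (fun ε => 2 / (γ * p) * ε ^ (-β)) ∧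
          (fun ε => RadialPB.chargeDensity N R A B p q (U ε) (r ε))
            ~[𝓝[>] 0] (fun ε => -(2 * g R / (γ ^ 2 * p)) * ε ^ (-2 * (β - 1)))) ∧
        (β = 2 →
          (fun ε => RadialPB.D R (U ε) (r ε))
            ~[𝓝[>] 0] (fun ε => 2 / (γ * p + 2 * N * g R / (R * (A - B))) * ε ^ (-2 : ℝ)) ∧
          (fun ε => RadialPB.chargeDensity N R A B p q (U ε) (r ε))
            ~[𝓝[>] 0] (fun ε =>
              -(2 * p * g R / (γ * p + 2 * N * g R / (R * (A - B))) ^ 2) * ε ^ (-2 : ℝ))) ∧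
        (2 < β →
          (fun ε => RadialPB.D R (U ε) (r ε))
            ~[𝓝[>] 0] (fun ε => R * (A - B) / (N * g R) * ε ^ (-2 : ℝ)) ∧
          (fun ε => RadialPB.chargeDensity N R A B p q (U ε) (r ε))
            ~[𝓝[>] 0] (fun ε =>
              -(p * R ^ 2 * (A - B) ^ 2 / (2 * N ^ 2 * g R)) * ε ^ (-2 : ℝ)) ∧
          -- `U_ε(R)` and `U_ε'(R)` have the same expansions
          (fun ε => U ε R -
              (2 / p * min 1 (β - 1) * Real.log (1 / ε) -
                2 / p * Real.log (√(B / (2 * p * g R)) *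
                  (γ * p * RadialPB.chi1 β + 2 * N * g R / (R * (A - B)) * RadialPB.chi2 β))))
            =o[𝓝[>] 0] (fun _ => (1 : ℝ)) ∧
          (fun ε => RadialPB.D R (U ε) R)
            ~[𝓝[>] 0] (fun ε => R * (A - B) / (N * g R) * ε ^ (-2 : ℝ))))) := by
  -- The constants are quantified afresh so that this applies both to `U` and, with the roles of
  -- `(A, p)` and `(B, q)` exchanged, to `-U`.
  have inc : ∀ {A B p q : ℝ} {U : ℝ → ℝ → ℝ}, B < A → 0 < B → 0 < p → 0 < q →
      (∀ ε : ℝ, 0 < ε → RadialPB.IsNeumannSolution N R A B p q g ε (U ε)) →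
      RadialPB.Params N R A B p q g ∧
        ∀ ε : ℝ, 0 < ε → RadialPB.IncSol N R A B p q g ε (U ε) := by
    intro A B p q U hBA hB hp hq hU
    have P : RadialPB.Params N R A B p q g := ⟨hN, hR, hB, hBA, hp, hq, hg, hgpos⟩
    exact ⟨P, fun ε hε => ⟨P, hε, hU ε hε⟩⟩
  have hU' : ∀ ε : ℝ, 0 < ε →
      RadialPB.IsNeumannSolution N R B A q p g ε ((fun ε x => -U ε x) ε) :=
    fun ε hε => (hU ε hε).neg
  refine ⟨fun h ε hε => ?_, fun h ε hε => ((inc h hB hp hq hU).2 ε hε).monotoneOn, fun κ hκ => ?_,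
    fun β hβ γ hγ r hr hlim => ⟨fun h => ?_, fun h => ?_⟩⟩
  · have hm := ((inc h hA hq hp hU').2 ε hε).monotoneOn
    exact fun x hx y hy hxy => neg_le_neg_iff.1 (hm hx hy hxy)
  · rcases lt_or_gt_of_ne hAB with h | h
    · obtain ⟨P, hI⟩ := inc h hA hq hp hU'
      simpa only [RadialPB.D_neg, abs_neg] using RadialPB.exists_eventually_interior_bound P hI hκ
    · obtain ⟨P, hI⟩ := inc h hB hp hq hU
      exact RadialPB.exists_eventually_interior_bound P hI hκ
  · obtain ⟨P, hI⟩ := inc h hA hq hp hU'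
    obtain ⟨h1, h2, h3, h4, h5⟩ := RadialPB.boundary_layer_expansion P hI hβ hγ hr hlim
    simp only [RadialPB.D_neg, RadialPB.chargeDensity_neg N R A B p q] at h3 h4 h5
    refine ⟨(tendsto_neg_atTop_atBot.comp h1).congr fun ε => neg_neg _,
      h2.neg_left.congr_left fun ε => by ring, fun hβ2 => ?_, fun hβ2 => ?_, fun hβ2 => ?_⟩
    · refine ⟨?_, ?_⟩
      · exact RadialPB.isEquivalent_of_neg (h3 hβ2).1 fun ε => by ring
      · exact RadialPB.isEquivalent_of_neg (h3 hβ2).2 fun ε => by ring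
    · refine ⟨?_, ?_⟩
      · exact RadialPB.isEquivalent_of_neg (h4 hβ2).1 fun ε => by ring
      · exact RadialPB.isEquivalent_of_neg (h4 hβ2).2 fun ε => by ring
    · obtain ⟨a1, a2, a3, a4⟩ := h5 hβ2
      refine ⟨?_, ?_, a3.neg_left.congr_left fun ε => by ring, ?_⟩
      · exact RadialPB.isEquivalent_of_neg a1 fun ε => by ring
      · exact RadialPB.isEquivalent_of_neg a2 fun ε => by ring
      · exact RadialPB.isEquivalent_of_neg a4 fun ε => by ring
  · obtain ⟨P, hI⟩ := inc h hB hp hq hU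
    exact RadialPB.boundary_layer_expansion P hI hβ hγ hr hlim
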